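/- Let $M$ be a locally compact Hausdorff space, $\mu$ a $\sigma$-finite Borel measure on $M$ with full support, and $X=\{X_t,t\ge 0;\ \mathbb P_x, x\in M\}$ a $\mu$-symmetric strong Markov process on $M$ (possibly with a finite lifetime) whose transition semigroup $T_tf(x)=\mathbb E_x[f(X_t)]$ is strongly continuous on $L^2(M;\mu)$; let $(\mathcal L,\mathcal D(\mathcal L))$ be its infinitesimal generator in $L^2(M;\mu)$. Let $S=\{S_t\}_{t\ge 0}$ be a driftless subordinator with Laplace exponent $\phi(\lambda)=\int_{(0,\infty)}(1-e^{-\lambda s})\,\nu(ds)$, where the Lévy measure $\nu$ satisfies $\int_{(0,\infty)}(1\wedge s)\,\nu(ds)<\infty$ and $\nu(0,\infty)=\infty$. Put $w(s)=\nu(s,\infty)$ for $s>0$ and $E_t=\inf\{s>0: S_s>t\}$ for $t\ge 0$. For $f\in L^2(M;\mu)$ and $u:[0,\infty)\to L^2(M;\mu)$, call $u$ a weak solution of $$\partial_t^w u=\mathcal L u,\qquad u(0)=f,$$ if $u(0)=f$, and (i) $t\mapsto u(t)$ is continuous from $[0,\infty)$ to $L^2(M;\mu)$ (consequently $I_t^w(u):=\int_0^t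 w(t-s)\,(u(s)-f)\,ds$ converges absolutely in $L^2(M;\mu)$ for every $t>0$); (ii) for every $g\in\mathcal D(\mathcal L)$ and every $t>0$, the derivative on the left exists and $$\frac{d}{dt}\int_M g(x)\,I_t^w(u)(x)\,\mu(dx)=\int_M u(t,x)\,\mathcal L g(x)\,\mu(dx).$$ Then, for every $f\in L^2(M;\mu)$: the expectation $u(t)=\mathbb E[T_{E_t}f]$ (over $S$, as a Bochner integral in $L^2(M;\mu)$) exists for every $t\ge 0$; $u$ is a weak solution, and $I^w_t(u)$ converges absolutely in $L^2(M;\mu)$ for every $t>0$. Conversely, every weak solution $v$ with initial value $f$ satisfies $v(t,x)=\mathbb E[T_{E_t}f](x)$ for $\mu$-a.e. $x\in M$, for every $t\ge 0$. -/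

import Mathlib

open MeasureTheory ProbabilityTheory Set Filter Topology
open scoped ENNReal NNReal

/-- A (temporally homogeneous) strong Markov process on `M`, realised on the sample space `Ω`.
The state space is enlarged by a cemetery point `∂ = Sum.inr ()`, so that a finite lifetime is
allowed (processes with infinite lifetime are those that never visit `∂`).  `P x` is the law of the
process started from `x`.  The strong Markov property is required at all stopping times of the
given filtration.  No path regularity is imposed, so in particular right-continuous strong Markov
processes are covered. -/
structure StrongMarkovProcess (M Ω : Type*) [MeasurableSpace M] [mΩ : MeasurableSpace Ω] where
  /-- the coordinate maps -/
  X : ℝ≥0 → Ω → M ⊕ Unit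
  /-- the filtration -/
  𝓕 : Filtration ℝ≥0 mΩ
  /-- the law of the process started at a given point -/
  P : M ⊕ Unit → Measure Ω
  isProbabilityMeasure : ∀ x, IsProbabilityMeasure (P x)
  adapted : ∀ t, Measurable[𝓕 t] (X t)
  start : ∀ x, ∀ᵐ ω ∂P x, X 0 ω = x
  absorbed : ∀ s t ω, s ≤ t → X s ω = Sum.inr () → X t ω = Sum.inr ()
  measurable_prob : ∀ t B, MeasurableSet B → Measurable fun x => P x (X t ⁻¹' B)
  measurable_stopped : ∀ (τ : Ω → WithTop ℝ≥0) (hτ : IsStoppingTime 𝓕 τ) (B : Set (M ⊕ Unit)),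
    MeasurableSet B → MeasurableSet[hτ.measurableSpace] {ω | τ ω ≠ ⊤ ∧ X ((τ ω).untopD 0) ω ∈ B}
  strong_markov : ∀ (τ : Ω → WithTop ℝ≥0) (hτ : IsStoppingTime 𝓕 τ) (t : ℝ≥0) (x : M ⊕ Unit)
    (B : Set (M ⊕ Unit)) (A : Set Ω), MeasurableSet B → MeasurableSet[hτ.measurableSpace] A →
    A ⊆ {ω | τ ω ≠ ⊤} →
    P x (A ∩ {ω | X ((τ ω).untopD 0 + t) ω ∈ B}) =
      ∫⁻ ω in A, P (X ((τ ω).untopD 0) ω) (X t ⁻¹' B) ∂P x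

namespace StrongMarkovProcess

variable {M Ω : Type*} [MeasurableSpace M] [MeasurableSpace Ω]

lemma measurableEmbedding_inl : MeasurableEmbedding (Sum.inl : M → M ⊕ Unit) :=
  ⟨Sum.inl_injective, measurable_inl, fun _ hs => measurableSet_inl_image.2 hs⟩

lemma measurable_X (X : StrongMarkovProcess M Ω) (t : ℝ≥0) : Measurable (X.X t) :=
  (X.adapted t).mono (X.𝓕.le t) le_rfl

lemma transition_apply (X : StrongMarkovProcess M Ω) (t : ℝ≥0) (x : M) {B : Set M}
    (hB : MeasurableSet B) :
    (((X.P (Sum.inl x)).map (X.X t)).comap Sum.inl) B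
      = X.P (Sum.inl x) (X.X t ⁻¹' (Sum.inl '' B)) := by
  rw [measurableEmbedding_inl.comap_apply,
    Measure.map_apply (X.measurable_X t) (measurableSet_inl_image.2 hB)]

/-- The transition kernel on `M`: `kernel t x B = P_x (X_t ∈ B)` (a sub-probability kernel, mass
being lost when the process has moved to the cemetery). -/
noncomputable def kernel (X : StrongMarkovProcess M Ω) (t : ℝ≥0) : Kernel M M where
  toFun x := ((X.P (Sum.inl x)).map (X.X t)).comap Sum.inl
  measurable' := by
    refine Measure.measurable_of_measurable_coe _ fun B hB => ?_
    simp_rw [X.transition_apply t _ hB]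
    exact (X.measurable_prob t _ (measurableSet_inl_image.2 hB)).comp measurable_inl

lemma kernel_univ_le (X : StrongMarkovProcess M Ω) (t : ℝ≥0) (x : M) :
    X.kernel t x univ ≤ 1 := by
  have := X.isProbabilityMeasure (Sum.inl x)
  exact (X.transition_apply t x MeasurableSet.univ).trans_le prob_le_one

instance (X : StrongMarkovProcess M Ω) (t : ℝ≥0) : IsFiniteKernel (X.kernel t) :=
  ⟨1, ENNReal.one_lt_top, X.kernel_univ_le t⟩

/-- The transition semigroup on functions, `T_t f(x) = E_x [f(X_t)]`, where `f(∂) = 0`. -/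
noncomputable def transition (X : StrongMarkovProcess M Ω) (t : ℝ≥0) (f : M → ℝ) (x : M) : ℝ :=
  ∫ y, f y ∂X.kernel t x

/-- `X` is `μ`-symmetric: `∫ (T_t f) g dμ = ∫ f (T_t g) dμ` for all nonnegative Borel `f`, `g`. -/
def IsSymmetric (X : StrongMarkovProcess M Ω) (μ : Measure M) : Prop :=
  ∀ (t : ℝ≥0) (f g : M → ℝ≥0∞), Measurable f → Measurable g →
    ∫⁻ x, (∫⁻ y, f y ∂X.kernel t x) * g x ∂μ = ∫⁻ x, f x * (∫⁻ y, g y ∂X.kernel t x) ∂μ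

variable {X : StrongMarkovProcess M Ω} {μ : Measure M}

lemma IsSymmetric.lintegral_le (hX : X.IsSymmetric μ) (t : ℝ≥0) {f : M → ℝ≥0∞}
    (hf : Measurable f) : ∫⁻ x, (∫⁻ y, f y ∂X.kernel t x) ∂μ ≤ ∫⁻ x, f x ∂μ := by
  have h := hX t f 1 hf measurable_one
  simp only [Pi.one_apply, mul_one, lintegral_const, one_mul] at h
  rw [h]
  refine lintegral_mono fun x => ?_
  calc f x * X.kernel t x univ ≤ f x * 1 := by gcongr; exact X.kernel_univ_le t x
    _ = f x := mul_one _

/-- `T_t f` does not depend, up to `μ`-null sets, on the representative of `f`. -/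
lemma IsSymmetric.transition_congr (hX : X.IsSymmetric μ) (t : ℝ≥0) {f g : M → ℝ}
    (h : f =ᵐ[μ] g) : X.transition t f =ᵐ[μ] X.transition t g := by
  obtain ⟨N, hN, hNm, hN0⟩ := exists_measurable_superset_of_null (ae_iff.1 h)
  have h1 := hX.lintegral_le t (measurable_one.indicator hNm : Measurable (N.indicator 1))
  rw [lintegral_indicator_one hNm, hN0, nonpos_iff_eq_zero] at h1
  simp_rw [lintegral_indicator_one hNm] at h1
  rw [lintegral_eq_zero_iff ((X.kernel t).measurable_coe hNm)] at h1
  filter_upwards [h1] with x hx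
  refine integral_congr_ae (ae_iff.2 (measure_mono_null hN hx))

/-- `T_t` maps `L²(M; μ)` to itself if `X` is `μ`-symmetric. -/
lemma IsSymmetric.memLp_transition (hX : X.IsSymmetric μ) (t : ℝ≥0) {f : M → ℝ}
    (hf : MemLp f 2 μ) : MemLp (X.transition t f) 2 μ := by
  obtain ⟨g, hg, hfg⟩ := hf.1
  refine (memLp_congr_ae (hX.transition_congr t hfg)).2 ?_
  have hg2 : MemLp g 2 μ := (memLp_congr_ae hfg).1 hf
  refine ⟨(hg.integral_kernel (κ := X.kernel t)).aestronglyMeasurable, ?_⟩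
  rw [eLpNorm_lt_top_iff_lintegral_rpow_enorm_lt_top (by norm_num) (by norm_num)]
  have hfin := (eLpNorm_lt_top_iff_lintegral_rpow_enorm_lt_top (p := 2) (by norm_num)
    (by norm_num)).1 hg2.2
  refine lt_of_le_of_lt (le_trans (lintegral_mono fun x => ?_)
    (hX.lintegral_le t (f := fun y => ‖g y‖ₑ ^ (2 : ℝ≥0∞).toReal) (by
      have := hg.measurable
      fun_prop))) hfin
  have h1 : ‖X.transition t g x‖ₑ ≤ ∫⁻ y, ‖g y‖ₑ ∂X.kernel t x := enorm_integral_le_lintegral_enorm _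
  have h2 := ENNReal.lintegral_mul_le_Lp_mul_Lq (X.kernel t x) Real.HolderConjugate.two_two
    (f := fun y => ‖g y‖ₑ) (g := 1) hg.measurable.enorm.aemeasurable aemeasurable_one
  simp only [Pi.mul_apply, Pi.one_apply, mul_one, ENNReal.one_rpow, lintegral_const, one_mul] at h2
  have h3 : (X.kernel t x univ) ^ (1 / 2 : ℝ) ≤ 1 :=
    ENNReal.rpow_le_one (X.kernel_univ_le t x) (by norm_num)
  have h4 := h1.trans (h2.trans (mul_le_of_le_one_right' h3))
  calc ‖X.transition t g x‖ₑ ^ (2 : ℝ≥0∞).toReal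
      ≤ ((∫⁻ y, ‖g y‖ₑ ^ (2 : ℝ) ∂X.kernel t x) ^ (1 / 2 : ℝ)) ^ (2 : ℝ) := by
        simp only [ENNReal.toReal_ofNat]
        exact ENNReal.rpow_le_rpow h4 (by norm_num)
    _ = ∫⁻ y, ‖g y‖ₑ ^ (2 : ℝ≥0∞).toReal ∂X.kernel t x := by
        rw [← ENNReal.rpow_mul]; norm_num

/-- The transition semigroup `T_t` on `L²(M; μ)` of a `μ`-symmetric process. -/
noncomputable def T (hX : X.IsSymmetric μ) (t : ℝ≥0) (f : Lp ℝ 2 μ) : Lp ℝ 2 μ :=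
  (hX.memLp_transition t (Lp.memLp f)).toLp (X.transition t f)

/-- Strong continuity of the transition semigroup on `L²(M; μ)`. -/
def IsStronglyContinuous (hX : X.IsSymmetric μ) : Prop :=
  ∀ f : Lp ℝ 2 μ, Tendsto (fun t => T hX t f) (𝓝[>] 0) (𝓝 f)

/-- `HasGenerator hX g h` means that `g ∈ D(L)` and `L g = h`, for the infinitesimal generator
`(L, D(L))` of the transition semigroup on `L²(M; μ)`. -/
def HasGenerator (hX : X.IsSymmetric μ) (g h : Lp ℝ 2 μ) : Prop :=
  Tendsto (fun t : ℝ≥0 => (t : ℝ)⁻¹ • (T hX t g - g)) (𝓝[>] 0) (𝓝 h)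

end StrongMarkovProcess

/-- `S` is a driftless subordinator on the probability space `(Ω, Pr)` with Lévy measure `ν`: a
non-decreasing real-valued Lévy process started at `0`, with
`E exp(-l S_t) = exp(-t φ(l))`, `φ(l) = ∫_{(0,∞)} (1 - exp(-l s)) ν(ds)`.
Only the restriction of `ν` to `(0,∞)` matters. -/
structure IsDriftlessSubordinator {Ω : Type*} [MeasurableSpace Ω] (S : ℝ≥0 → Ω → ℝ)
    (ν : Measure ℝ) (Pr : Measure Ω) : Prop where
  levy : ∫⁻ s in Ioi (0 : ℝ), ENNReal.ofReal (min 1 s) ∂ν < ∞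
  measurable : ∀ t, Measurable (S t)
  zero : ∀ᵐ ω ∂Pr, S 0 ω = 0
  mono : ∀ᵐ ω ∂Pr, Monotone fun t => S t ω
  right_cont : ∀ᵐ ω ∂Pr, ∀ t, ContinuousWithinAt (fun r => S r ω) (Ici t) t
  indep_increments : HasIndepIncrements S Pr
  stationary : ∀ s t, IdentDistrib (fun ω => S (s + t) ω - S s ω) (S t) Pr Pr
  laplace : ∀ (t : ℝ≥0) (l : ℝ), 0 < l →
    ∫ ω, Real.exp (-(l * S t ω)) ∂Pr
      = Real.exp (-(t * ∫ s in Ioi (0 : ℝ), (1 - Real.exp (-(l * s))) ∂ν))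

/-- The inverse subordinator `E_t = inf {s > 0 : S_s > t}`. -/
noncomputable def inverseSubordinator {Ω : Type*} (S : ℝ≥0 → Ω → ℝ) (t : ℝ) (ω : Ω) : ℝ≥0 :=
  sInf {s : ℝ≥0 | 0 < s ∧ t < S s ω}

/-- The tail `w(s) = ν(s, ∞)` of the Lévy measure. -/
noncomputable def levyTail (ν : Measure ℝ) (s : ℝ) : ℝ := ν.real (Ioi s)

namespace StrongMarkovProcess

variable {M Ω : Type*} [MeasurableSpace M] [MeasurableSpace Ω]
  {X : StrongMarkovProcess M Ω} {μ : Measure M}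

/-- `u(t) = E [T_{E_t} f]`, the expectation being a Bochner integral in `L²(M; μ)`. -/
noncomputable def subordinate {Ω' : Type*} [MeasurableSpace Ω'] (hX : X.IsSymmetric μ)
    (S : ℝ≥0 → Ω' → ℝ) (Pr : Measure Ω') (f : Lp ℝ 2 μ) (t : ℝ) : Lp ℝ 2 μ :=
  ∫ ω, T hX (inverseSubordinator S t ω) f ∂Pr

/-- `I_t^w u = ∫_0^t w(t - s) (u(s) - f) ds`, a Bochner integral in `L²(M; μ)`. -/
noncomputable def fracIntegral (w : ℝ → ℝ) (f : Lp ℝ 2 μ) (u : ℝ → Lp ℝ 2 μ) (t : ℝ) : Lp ℝ 2 μ :=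
  ∫ s in Ioc 0 t, w (t - s) • (u s - f)

/-- `u : [0,∞) → L²(M; μ)` is a weak solution of `∂_t^w u = L u`, `u(0) = f`. -/
structure IsWeakSolution (hX : X.IsSymmetric μ) (w : ℝ → ℝ) (f : Lp ℝ 2 μ)
    (u : ℝ → Lp ℝ 2 μ) : Prop where
  initial : u 0 = f
  continuousOn : ContinuousOn u (Ici 0)
  hasDerivAt : ∀ g Lg : Lp ℝ 2 μ, HasGenerator hX g Lg → ∀ t : ℝ, 0 < t →
    HasDerivAt (fun r => ∫ x, g x * fracIntegral w f u r x ∂μ) (∫ x, u t x * Lg x ∂μ) t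

end StrongMarkovProcess

/-! Everything rests on one identity between measures on the half-line: P(σ_r ≥ s) ds is the
convolution of w(x) dx with the potential measure ∫_0^r P(σ_a ∈ ·) da. Both have Laplace transform
(1 - exp(-rφ(l)))/l, because w has transform φ(l)/l (`survivalMeasure_eq_potentialTailMeasure`).

Existence: evaluate the identity on (-∞, t). Since {e_s ≤ r} = {s ≤ σ_r}, this computes the
occupation measure of the inverse e on (0, t). Integrating k(a) = ⟨f, T_a Lg⟩, a derivative of η(a)
= ⟨f, T_a g⟩, against it gives ∫_0^t ⟨u(s), Lg⟩ ds = ∫_0^t w(x) ⟨u(t-x) - f, g⟩ dx, the weak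
equation in integrated form (`integral_comp_inverse_eq`).

Uniqueness: let v be the difference of two weak solutions, extended by 0 to negative times, and b
its primitive, so that w * ⟨v, g⟩ = ⟨b, Lg⟩. Test the identity on s ↦ ⟨v(t-s), g⟩: then V(r) = E b(t
- σ_r) satisfies ⟨V(0), g⟩ - ⟨V(r), g⟩ = ∫_0^r ⟨V(a), Lg⟩ da, that is V' = -LV weakly. V is bounded
and tends to 0, because σ_r → ∞ and b vanishes on (-∞, 0]. As ⟨V(r), T_r g⟩ is constant in r, V(0) =
b(t) is 0 (`eq_zero_of_backward`). The solution itself is never Laplace transformed, so no growth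
condition on v is needed. -/

/-! ### Uniqueness of Laplace transforms -/

/-- The complex moment generating functions are analytic on Re z < 1 and agree at real points, hence
on the imaginary axis, where they are the characteristic functions. -/
theorem MeasureTheory.Measure.ext_of_laplace_of_isFiniteMeasure {m₁ m₂ : Measure ℝ}
    [IsFiniteMeasure m₁] [IsFiniteMeasure m₂]
    (hfin : ∀ t < 1, ∫⁻ x, ENNReal.ofReal (Real.exp (t * x)) ∂m₁ < ∞)
    (h : ∀ t < 1, ∫⁻ x, ENNReal.ofReal (Real.exp (t * x)) ∂m₁
      = ∫⁻ x, ENNReal.ofReal (Real.exp (t * x)) ∂m₂) : m₁ = m₂ := by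
  have key : ∀ m : Measure ℝ, (∀ t < 1, ∫⁻ x, ENNReal.ofReal (Real.exp (t * x)) ∂m < ∞) →
      Iio 1 ⊆ interior (integrableExpSet id m) := by
    intro m hm
    refine interior_maximal (fun t ht => ?_) isOpen_Iio
    refine ⟨by fun_prop, ?_⟩
    rw [hasFiniteIntegral_iff_ofReal (ae_of_all _ fun x => (Real.exp_pos _).le)]
    exact hm t ht
  have hk₁ := key m₁ hfin
  have hk₂ := key m₂ fun t ht => h t ht ▸ hfin t ht
  have hmgf : ∀ t < 1, mgf id m₁ t = mgf id m₂ t := by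
    intro t ht
    simp only [mgf, id]
    rw [integral_eq_lintegral_of_nonneg_ae (ae_of_all _ fun x => (Real.exp_pos _).le) (by fun_prop),
      integral_eq_lintegral_of_nonneg_ae (ae_of_all _ fun x => (Real.exp_pos _).le) (by fun_prop),
      h t ht]
  have hU : IsPreconnected {z : ℂ | z.re ∈ Iio (1 : ℝ)} :=
    ((convex_Iio (1 : ℝ)).linear_preimage Complex.reLm).isPreconnected
  have heq : EqOn (complexMGF id m₁) (complexMGF id m₂) {z : ℂ | z.re ∈ Iio (1 : ℝ)} := by
    refine AnalyticOnNhd.eqOn_of_preconnected_of_frequently_eq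
      (analyticOnNhd_complexMGF.mono fun z hz => hk₁ hz)
      (analyticOnNhd_complexMGF.mono fun z hz => hk₂ hz) hU (z₀ := 0) (by simp) ?_
    rw [frequently_iff_seq_forall]
    -- Real points different from 0 that accumulate at 0, inside the half-plane.
    refine ⟨fun n : ℕ => ((-(1 / ((n : ℝ) + 1)) : ℝ) : ℂ), ?_, fun n => ?_⟩
    · rw [tendsto_nhdsWithin_iff]
      refine ⟨?_, Eventually.of_forall fun n => ?_⟩
      · rw [← Complex.ofReal_zero]
        refine (Complex.continuous_ofReal.tendsto 0).comp ?_
        simpa using (tendsto_one_div_add_atTop_nhds_zero_nat (𝕜 := ℝ)).neg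
      · have : (0 : ℝ) < 1 / ((n : ℝ) + 1) := by positivity
        simp only [mem_compl_iff, mem_singleton_iff, Complex.ofReal_eq_zero]
        linarith
    · rw [complexMGF_ofReal, complexMGF_ofReal, hmgf]
      have : (0 : ℝ) < 1 / ((n : ℝ) + 1) := by positivity
      linarith
  refine Measure.ext_of_charFun (funext fun t => ?_)
  rw [← complexMGF_id_mul_I, ← complexMGF_id_mul_I]
  exact heq (by simp)

/-- The measures may be infinite. Tilting by exp(-x) makes them finite and turns l > 0 into t = 1 -
l < 1; the tilt is undone because its density is positive and finite. -/
theorem MeasureTheory.Measure.ext_of_laplace {m₁ m₂ : Measure ℝ}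
    (hfin : ∀ l > 0, ∫⁻ x, ENNReal.ofReal (Real.exp (-(l * x))) ∂m₁ < ∞)
    (h : ∀ l > 0, ∫⁻ x, ENNReal.ofReal (Real.exp (-(l * x))) ∂m₁
      = ∫⁻ x, ENNReal.ofReal (Real.exp (-(l * x))) ∂m₂) : m₁ = m₂ := by
  set d : ℝ → ℝ≥0∞ := fun x => ENNReal.ofReal (Real.exp (-(1 * x))) with hd
  have hdm : Measurable d := by fun_prop
  have hd0 : ∀ x, d x ≠ 0 := fun x => by simp [hd, Real.exp_pos]
  have hcalc : ∀ (m : Measure ℝ) (t : ℝ),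
      ∫⁻ x, ENNReal.ofReal (Real.exp (t * x)) ∂m.withDensity d
        = ∫⁻ x, ENNReal.ofReal (Real.exp (-((1 - t) * x))) ∂m := by
    intro m t
    rw [lintegral_withDensity_eq_lintegral_mul _ hdm (by fun_prop)]
    refine lintegral_congr fun x => ?_
    rw [Pi.mul_apply, hd, ← ENNReal.ofReal_mul (Real.exp_pos _).le, ← Real.exp_add]
    congr 2
    ring
  have : IsFiniteMeasure (m₁.withDensity d) :=
    isFiniteMeasure_withDensity (hfin 1 one_pos).ne
  have : IsFiniteMeasure (m₂.withDensity d) :=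
    isFiniteMeasure_withDensity ((h 1 one_pos) ▸ (hfin 1 one_pos).ne)
  have heq : m₁.withDensity d = m₂.withDensity d := by
    refine ext_of_laplace_of_isFiniteMeasure (fun t ht => ?_) fun t ht => ?_
    · rw [hcalc]; exact hfin _ (by linarith)
    · rw [hcalc, hcalc]; exact h _ (by linarith)
  have hinv : ∀ m : Measure ℝ, (m.withDensity d).withDensity d⁻¹ = m := fun m =>
    withDensity_inv_same hdm (ae_of_all _ hd0) (ae_of_all _ fun x => ENNReal.ofReal_ne_top)
  rw [← hinv m₁, heq, hinv]

/-! ### The Laplace exponent and the tail of the Lévy measure -/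

section LevyMeasure

variable {ν : Measure ℝ}

theorem levyMeasure_Ioi_lt_top (hν : ∫⁻ s in Ioi (0 : ℝ), ENNReal.ofReal (min 1 s) ∂ν < ∞)
    {x : ℝ} (hx : 0 < x) : ν (Ioi x) < ∞ := by
  have h0 : ENNReal.ofReal (min 1 x) ≠ 0 := by simp [hx]
  have h1 := mul_meas_ge_le_lintegral (μ := ν.restrict (Ioi 0))
    (f := fun s => ENNReal.ofReal (min 1 s)) (by fun_prop) (ENNReal.ofReal (min 1 x))
  have h2 : ν (Ioi x) ≤ (ν.restrict (Ioi 0))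
      {s | ENNReal.ofReal (min 1 x) ≤ ENNReal.ofReal (min 1 s)} := by
    rw [Measure.restrict_apply (measurableSet_le (by fun_prop) (by fun_prop))]
    refine measure_mono fun s hs => ⟨?_, hx.trans hs⟩
    exact ENNReal.ofReal_le_ofReal (min_le_min le_rfl (le_of_lt hs))
  refine h2.trans_lt ?_
  by_contra hcon
  rw [not_lt, top_le_iff] at hcon
  rw [hcon, ENNReal.mul_top h0] at h1
  exact absurd hν (not_lt.2 h1)

theorem ofReal_levyTail (hν : ∫⁻ s in Ioi (0 : ℝ), ENNReal.ofReal (min 1 s) ∂ν < ∞)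
    {x : ℝ} (hx : 0 < x) : ENNReal.ofReal (levyTail ν x) = ν (Ioi x) :=
  ENNReal.ofReal_toReal (levyMeasure_Ioi_lt_top hν hx).ne

theorem levyTail_nonneg (x : ℝ) : 0 ≤ levyTail ν x := ENNReal.toReal_nonneg

theorem measurable_levyTail : Measurable (levyTail ν) := by
  have : Antitone fun x : ℝ => ν (Ioi x) := fun x y h => measure_mono (Ioi_subset_Ioi h)
  exact this.measurable.ennreal_toReal

theorem integrable_one_sub_exp (hν : ∫⁻ s in Ioi (0 : ℝ), ENNReal.ofReal (min 1 s) ∂ν < ∞)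
    {l : ℝ} (hl : 0 < l) : IntegrableOn (fun s => 1 - Real.exp (-(l * s))) (Ioi 0) ν := by
  -- Dominating function: 1 - exp(-ls) is at most 1, used for s ≥ 1, and at most ls, used for s ≤ 1.
  have h1 : IntegrableOn (fun s => max 1 l * min 1 s) (Ioi 0) ν := by
    refine Integrable.const_mul ⟨by fun_prop, ?_⟩ _
    rw [hasFiniteIntegral_iff_ofReal]
    · exact hν
    · filter_upwards [ae_restrict_mem measurableSet_Ioi] with s hs
      exact le_min zero_le_one (le_of_lt hs)
  refine h1.mono' (by fun_prop) ?_
  filter_upwards [ae_restrict_mem measurableSet_Ioi] with s hs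
  have hs : 0 < s := hs
  have h2 : Real.exp (-(l * s)) ≤ 1 := Real.exp_le_one_iff.2 (by nlinarith)
  have h3 := Real.add_one_le_exp (-(l * s))
  have h4 := Real.exp_pos (-(l * s))
  rw [Real.norm_of_nonneg (by linarith)]
  have h5 : (1 : ℝ) ≤ max 1 l := le_max_left _ _
  have h6 : l ≤ max 1 l := le_max_right _ _
  rcases le_total 1 s with h | h
  · rw [min_eq_left h]; linarith
  · rw [min_eq_right h]; nlinarith

/-- The Laplace exponent of a driftless subordinator with Lévy measure `ν`. -/
noncomputable def laplaceExponent (ν : Measure ℝ) (l : ℝ) : ℝ :=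
  ∫ s in Ioi (0 : ℝ), (1 - Real.exp (-(l * s))) ∂ν

theorem laplaceExponent_pos (hν : ∫⁻ s in Ioi (0 : ℝ), ENNReal.ofReal (min 1 s) ∂ν < ∞)
    (hinf : ν (Ioi 0) = ∞) {l : ℝ} (hl : 0 < l) : 0 < laplaceExponent ν l := by
  have hpos : ∀ s ∈ Ioi (0 : ℝ), 0 < 1 - Real.exp (-(l * s)) := fun s hs => by
    have : Real.exp (-(l * s)) < 1 := Real.exp_lt_one_iff.2 (by have : 0 < s := hs; nlinarith)
    linarith
  rw [laplaceExponent, setIntegral_pos_iff_support_of_nonneg_ae _ (integrable_one_sub_exp hν hl)]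
  · have hsub : Ioi 0 ⊆ Function.support fun s => 1 - Real.exp (-(l * s)) :=
      fun s hs => (hpos s hs).ne'
    rw [inter_eq_right.2 hsub, hinf]
    simp
  · filter_upwards [ae_restrict_mem measurableSet_Ioi] with s hs using (hpos s hs).le

/-- Monotone convergence: the integrands increase to 1, whose integral is the infinite mass of ν. -/
theorem tendsto_laplaceExponent (hν : ∫⁻ s in Ioi (0 : ℝ), ENNReal.ofReal (min 1 s) ∂ν < ∞)
    (hinf : ν (Ioi 0) = ∞) :
    Tendsto (fun n : ℕ => laplaceExponent ν (n + 1)) atTop atTop := by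
  have h1 : ∀ n : ℕ, ENNReal.ofReal (laplaceExponent ν (n + 1))
      = ∫⁻ s in Ioi (0 : ℝ), ENNReal.ofReal (1 - Real.exp (-((n + 1 : ℝ) * s))) ∂ν := by
    intro n
    rw [laplaceExponent, ofReal_integral_eq_lintegral_ofReal
      (integrable_one_sub_exp hν (by positivity))]
    filter_upwards [ae_restrict_mem measurableSet_Ioi] with s hs
    have : Real.exp (-((n + 1 : ℝ) * s)) ≤ 1 := Real.exp_le_one_iff.2 (by
      have : 0 < s := hs
      have : 0 ≤ (n + 1 : ℝ) * s := by positivity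
      linarith)
    simpa using this
  rw [← ENNReal.tendsto_ofReal_nhds_top]
  simp_rw [h1]
  have : (∫⁻ s in Ioi (0 : ℝ), 1 ∂ν) = ∞ := by simp [hinf]
  rw [← this]
  refine lintegral_tendsto_of_tendsto_of_monotone (fun n => by fun_prop) ?_ ?_
  · filter_upwards [ae_restrict_mem measurableSet_Ioi] with s hs
    intro n m hnm
    have hs : 0 < s := hs
    refine ENNReal.ofReal_le_ofReal ?_
    have : (n : ℝ) ≤ m := by exact_mod_cast hnm
    have : Real.exp (-((m + 1 : ℝ) * s)) ≤ Real.exp (-((n + 1 : ℝ) * s)) :=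
      Real.exp_le_exp.2 (by nlinarith)
    linarith
  · filter_upwards [ae_restrict_mem measurableSet_Ioi] with s hs
    have hs : 0 < s := hs
    rw [← ENNReal.ofReal_one]
    refine ENNReal.tendsto_ofReal ?_
    have h2 : Tendsto (fun n : ℕ => (n + 1 : ℝ) * s) atTop atTop :=
      (tendsto_atTop_add_const_right _ 1 tendsto_natCast_atTop_atTop).atTop_mul_const hs
    have h3 := (Real.tendsto_exp_neg_atTop_nhds_zero.comp h2).const_sub 1
    simpa using h3

theorem integral_exp_neg_mul {l : ℝ} (hl : l ≠ 0) (x : ℝ) :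
    ∫ t in (0 : ℝ)..x, Real.exp (-(l * t)) = (1 - Real.exp (-(l * x))) / l := by
  have : ∀ t ∈ uIcc 0 x, HasDerivAt (fun t => -Real.exp (-(l * t)) / l)
      (Real.exp (-(l * t))) t := by
    intro t _
    refine (((hasDerivAt_id t).const_mul l).neg.exp.neg.div_const l).congr_deriv ?_
    simp
    field_simp
  rw [intervalIntegral.integral_eq_sub_of_hasDerivAt this
    (Continuous.intervalIntegrable (by fun_prop) _ _)]
  simp
  ring

/-- `∫_0^∞ exp(-l x) w(x) dx = φ(l) / l`. -/
theorem lintegral_exp_mul_levyTail (hν : ∫⁻ s in Ioi (0 : ℝ), ENNReal.ofReal (min 1 s) ∂ν < ∞)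
    {l : ℝ} (hl : 0 < l) :
    ∫⁻ x in Ioi (0 : ℝ), ENNReal.ofReal (Real.exp (-(l * x))) * ENNReal.ofReal (levyTail ν x)
      = ENNReal.ofReal (laplaceExponent ν l / l) := by
  -- Layer-cake formula for the primitive (1 - exp(-ls))/l of exp(-l·).
  have h1 := lintegral_comp_eq_lintegral_meas_lt_mul (ν.restrict (Ioi 0)) (f := id)
    (g := fun x => Real.exp (-(l * x)))
    (by filter_upwards [ae_restrict_mem measurableSet_Ioi] with s hs using le_of_lt hs)
    aemeasurable_id (fun t _ => Continuous.intervalIntegrable (by fun_prop) _ _)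
    (ae_of_all _ fun x => (Real.exp_pos _).le)
  have hI := (integrable_one_sub_exp hν hl).div_const l
  have hnn : 0 ≤ᵐ[ν.restrict (Ioi 0)] fun s => (1 - Real.exp (-(l * s))) / l := by
    filter_upwards [ae_restrict_mem measurableSet_Ioi] with s hs
    have : Real.exp (-(l * s)) ≤ 1 := Real.exp_le_one_iff.2 (by have : 0 < s := hs; nlinarith)
    exact div_nonneg (by linarith) hl.le
  simp only [id, integral_exp_neg_mul hl.ne'] at h1
  rw [← ofReal_integral_eq_lintegral_ofReal hI hnn, integral_div] at h1
  rw [laplaceExponent, h1]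
  refine setLIntegral_congr_fun measurableSet_Ioi fun x hx => ?_
  rw [ofReal_levyTail hν hx, mul_comm,
    Measure.restrict_apply (measurableSet_lt (by fun_prop) (by fun_prop))]
  congr 2
  ext s
  simp only [mem_Ioi, mem_inter_iff, mem_ofPred_eq]
  exact ⟨fun h => ⟨h, lt_trans hx h⟩, fun h => h.1⟩

theorem integrableOn_levyTail (hν : ∫⁻ s in Ioi (0 : ℝ), ENNReal.ofReal (min 1 s) ∂ν < ∞)
    (t : ℝ) : IntegrableOn (levyTail ν) (Ioc 0 t) := by
  refine ⟨measurable_levyTail.aestronglyMeasurable, ?_⟩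
  rw [hasFiniteIntegral_iff_ofReal (ae_of_all _ levyTail_nonneg)]
  have h := lintegral_exp_mul_levyTail hν one_pos
  calc ∫⁻ x in Ioc 0 t, ENNReal.ofReal (levyTail ν x)
      ≤ ∫⁻ x in Ioc 0 t, ENNReal.ofReal (Real.exp t) *
        (ENNReal.ofReal (Real.exp (-(1 * x))) * ENNReal.ofReal (levyTail ν x)) := by
        refine setLIntegral_mono (by have := measurable_levyTail (ν := ν); fun_prop) fun x hx => ?_
        rw [← mul_assoc, ← ENNReal.ofReal_mul (Real.exp_pos _).le, ← Real.exp_add]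
        refine le_mul_of_one_le_left' ?_
        rw [ENNReal.one_le_ofReal, Real.one_le_exp_iff]
        linarith [hx.2]
    _ ≤ ∫⁻ x in Ioi 0, ENNReal.ofReal (Real.exp t) *
        (ENNReal.ofReal (Real.exp (-(1 * x))) * ENNReal.ofReal (levyTail ν x)) :=
        lintegral_mono_set Ioc_subset_Ioi_self
    _ < ∞ := by
        rw [lintegral_const_mul _ (by have := measurable_levyTail (ν := ν); fun_prop), h]
        exact ENNReal.mul_lt_top ENNReal.ofReal_lt_top ENNReal.ofReal_lt_top

end LevyMeasure

/-! ### Path properties of the subordinator -/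

/-- Strictly increasing right-continuous unbounded paths issued from `0`. -/
structure IsRegularPath (x : ℝ≥0 → ℝ) : Prop where
  zero : x 0 = 0
  strictMono : StrictMono x
  right_cont : ∀ t, ContinuousWithinAt x (Ici t) t
  tendsto : Tendsto x atTop atTop

theorem isRegularPath_coe : IsRegularPath (fun t : ℝ≥0 => (t : ℝ)) where
  zero := rfl
  strictMono := fun _ _ h => h
  right_cont := fun _ => NNReal.continuous_coe.continuousWithinAt
  tendsto := NNReal.tendsto_coe_atTop.2 tendsto_id

namespace IsDriftlessSubordinator

variable {Ω : Type*} [MeasurableSpace Ω] {S : ℝ≥0 → Ω → ℝ} {ν : Measure ℝ} {Pr : Measure Ω}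

theorem ae_nonneg (hS : IsDriftlessSubordinator S ν Pr) : ∀ᵐ ω ∂Pr, ∀ t, 0 ≤ S t ω := by
  filter_upwards [hS.zero, hS.mono] with ω h0 hm t
  exact h0 ▸ hm (zero_le (a := t))

variable [IsProbabilityMeasure Pr]

/-- Chernoff bound. Letting l → ∞ with K = 0 gives positivity of S_t; letting t → ∞ with l = 1 gives
divergence of the paths. -/
theorem measureReal_le (hS : IsDriftlessSubordinator S ν Pr) (t : ℝ≥0) {l : ℝ} (hl : 0 < l)
    (K : ℝ) : Pr.real {ω | S t ω ≤ K}
      ≤ Real.exp (l * K) * Real.exp (-(t * laplaceExponent ν l)) := by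
  have hint : Integrable (fun ω => Real.exp (-l * S t ω)) Pr := by
    have := hS.measurable t
    refine (integrable_const (1 : ℝ)).mono' (by fun_prop) ?_
    filter_upwards [hS.ae_nonneg] with ω h
    rw [Real.norm_of_nonneg (Real.exp_pos _).le, Real.exp_le_one_iff]
    nlinarith [h t]
  have h := measure_le_le_exp_mul_mgf (X := S t) (μ := Pr) K (neg_nonpos.2 hl.le) hint
  rw [neg_neg] at h
  refine h.trans_eq ?_
  have h2 := hS.laplace t l hl
  rw [mgf]
  simp only [neg_mul]
  rw [h2, laplaceExponent]

theorem ae_pos (hS : IsDriftlessSubordinator S ν Pr) (hν : ν (Ioi 0) = ∞) {t : ℝ≥0}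
    (ht : 0 < t) : Pr {ω | S t ω ≤ 0} = 0 := by
  rw [← measureReal_eq_zero_iff]
  refine le_antisymm (ge_of_tendsto' (f := fun n : ℕ =>
    Real.exp (-(t * laplaceExponent ν (n + 1)))) (x := atTop) ?_ fun n => ?_) measureReal_nonneg
  · have ht' : (0 : ℝ) < t := ht
    exact Real.tendsto_exp_neg_atTop_nhds_zero.comp
      ((tendsto_laplaceExponent hS.levy hν).const_mul_atTop ht')
  · have := hS.measureReal_le t (l := n + 1) (by positivity) 0
    simpa using this

/-- By stationarity the increments are positive almost surely, simultaneously over a countable dense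
set of times; monotonicity spreads this to all times. -/
theorem ae_strictMono (hS : IsDriftlessSubordinator S ν Pr) (hν : ν (Ioi 0) = ∞) :
    ∀ᵐ ω ∂Pr, StrictMono fun t => S t ω := by
  obtain ⟨D, hDc, hD⟩ := TopologicalSpace.exists_countable_dense ℝ≥0
  have h1 : ∀ p ∈ D, ∀ q ∈ D, p < q → ∀ᵐ ω ∂Pr, S p ω < S q ω := by
    intro p _ q _ hpq
    have h2 := (hS.stationary p (q - p)).measure_mem_eq (s := Iic 0) measurableSet_Iic
    rw [add_tsub_cancel_of_le hpq.le] at h2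
    have h3 : Pr (S (q - p) ⁻¹' Iic 0) = 0 := hS.ae_pos hν (tsub_pos_of_lt hpq)
    rw [h3] at h2
    rw [ae_iff]
    convert h2 using 2
    ext ω
    simp
  have h2 : ∀ᵐ ω ∂Pr, ∀ p ∈ D, ∀ q ∈ D, p < q → S p ω < S q ω := by
    rw [ae_ball_iff hDc]
    intro p hp
    rw [ae_ball_iff hDc]
    intro q hq
    by_cases hpq : p < q
    · filter_upwards [h1 p hp q hq hpq] with ω h _ using h
    · exact ae_of_all _ fun ω h => absurd h hpq
  filter_upwards [h2, hS.mono] with ω h hm s t hst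
  obtain ⟨p, hp, hsp, hpt⟩ := hD.exists_between hst
  obtain ⟨q, hq, hpq, hqt⟩ := hD.exists_between hpt
  exact (hm hsp.le).trans_lt ((h p hp q hq hpq).trans_le (hm hqt.le))

theorem ae_tendsto (hS : IsDriftlessSubordinator S ν Pr) (hν : ν (Ioi 0) = ∞) :
    ∀ᵐ ω ∂Pr, Tendsto (fun t => S t ω) atTop atTop := by
  have h1 : ∀ K : ℕ, ∀ᵐ ω ∂Pr, ∃ n : ℕ, (K : ℝ) < S n ω := by
    intro K
    rw [ae_iff, ← measureReal_eq_zero_iff]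
    refine le_antisymm (ge_of_tendsto' (f := fun n : ℕ =>
      Real.exp (1 * K) * Real.exp (-(n * laplaceExponent ν 1))) (x := atTop) ?_ fun n => ?_)
      measureReal_nonneg
    · have := (Real.tendsto_exp_neg_atTop_nhds_zero.comp (tendsto_natCast_atTop_atTop.atTop_mul_const
        (laplaceExponent_pos hS.levy hν one_pos))).const_mul (Real.exp (1 * K))
      simpa using this
    · have := hS.measureReal_le n one_pos K
      rw [NNReal.coe_natCast] at this
      refine le_trans (measureReal_mono fun ω hω => ?_) this
      simp only [mem_ofPred_eq, not_exists, not_lt] at hω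
      exact hω n
  filter_upwards [ae_all_iff.2 h1, hS.mono] with ω h hm
  refine tendsto_atTop_atTop_of_monotone hm fun b => ?_
  obtain ⟨K, hK⟩ := exists_nat_ge b
  obtain ⟨n, hn⟩ := h K
  exact ⟨n, hK.trans hn.le⟩

/-- On a measurable null set containing the bad paths, the path is replaced by t ↦ t. Regularity
then holds for every ω, as joint measurability requires below. -/
theorem exists_regular_modification (hS : IsDriftlessSubordinator S ν Pr) (hν : ν (Ioi 0) = ∞) :
    ∃ S' : ℝ≥0 → Ω → ℝ, (∀ t, Measurable (S' t)) ∧ (∀ ω, IsRegularPath fun t => S' t ω) ∧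
      ∀ᵐ ω ∂Pr, ∀ t, S' t ω = S t ω := by
  classical
  have hreg : ∀ᵐ ω ∂Pr, IsRegularPath fun t => S t ω := by
    filter_upwards [hS.zero, hS.ae_strictMono hν, hS.right_cont, hS.ae_tendsto hν]
      with ω h0 h1 h2 h3 using ⟨h0, h1, h2, h3⟩
  obtain ⟨N, hN, hNm, hN0⟩ := exists_measurable_superset_of_null (ae_iff.1 hreg)
  refine ⟨fun t ω => if ω ∈ N then (t : ℝ) else S t ω,
    fun t => Measurable.ite hNm measurable_const (hS.measurable t), fun ω => ?_, ?_⟩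
  · by_cases h : ω ∈ N
    · simpa only [h, if_true] using isRegularPath_coe
    · simp only [h, if_false]
      by_contra hc
      exact h (hN hc)
  · filter_upwards [measure_eq_zero_iff_ae_notMem.1 hN0] with ω h t
    simp [h]

end IsDriftlessSubordinator

/-! ### The inverse of a regular path -/

section Inverse

variable {Ω : Type*} {S : ℝ≥0 → Ω → ℝ} {ω : Ω}

/-- Right-continuity leaves room for some r > a with S_r < t, which bounds the infimum from below by
r; this is why both inequalities can be strict. -/
theorem IsRegularPath.lt_inverse_iff (h : IsRegularPath fun t => S t ω) (a : ℝ≥0) {t : ℝ} :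
    S a ω < t ↔ a < inverseSubordinator S t ω := by
  constructor
  · intro hat
    have h1 : ∀ᶠ r in 𝓝[>] a, S r ω < t :=
      ((h.right_cont a).mono Ioi_subset_Ici_self).eventually_lt_const hat
    obtain ⟨r, hr, har⟩ := (h1.and self_mem_nhdsWithin).exists
    refine lt_of_lt_of_le har (le_csInf ?_ fun s hs => ?_)
    · obtain ⟨s, hs⟩ := ((h.tendsto.eventually_gt_atTop t).and (eventually_gt_atTop 0)).exists
      exact ⟨s, hs.2, hs.1⟩
    · exact (h.strictMono.lt_iff_lt.1 (hr.trans hs.2)).le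
  · intro hat
    obtain ⟨r, har, hr⟩ := exists_between hat
    have h1 := notMem_of_lt_csInf hr (OrderBot.bddBelow _)
    simp only [mem_ofPred_eq, not_and, not_lt] at h1
    exact (h.strictMono har).trans_le (h1 (bot_le.trans_lt har))

theorem IsRegularPath.nonneg {x : ℝ≥0 → ℝ} (h : IsRegularPath x) (a : ℝ≥0) : 0 ≤ x a :=
  h.zero ▸ h.strictMono.monotone (zero_le (a := a))

theorem IsRegularPath.inverse_le_iff (h : IsRegularPath fun t => S t ω) (a : ℝ≥0) {t : ℝ} :
    inverseSubordinator S t ω ≤ a ↔ t ≤ S a ω := by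
  rw [← not_lt, ← h.lt_inverse_iff a, not_lt]

/-- A monotone surjection is continuous, and every level a is attained at time S_a because S is
strictly increasing. -/
theorem IsRegularPath.continuous_inverse (h : IsRegularPath fun t => S t ω) :
    Continuous fun t : ℝ => inverseSubordinator S (max t 0) ω := by
  refine Monotone.continuous_of_surjective (fun s t hst => ?_) fun a => ⟨S a ω, ?_⟩
  · have h1 := (h.inverse_le_iff (inverseSubordinator S (max t 0) ω)).1 le_rfl
    exact (h.inverse_le_iff _).2 ((max_le_max_right 0 hst).trans h1)
  · rw [max_eq_left (h.nonneg a)]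
    refine le_antisymm ((h.inverse_le_iff a).2 le_rfl) ?_
    have h1 := (h.inverse_le_iff (inverseSubordinator S (S a ω) ω)).1 le_rfl
    exact h.strictMono.le_iff_le.1 h1

end Inverse

/-- An increasing process `σ` and its (continuous) inverse `e`, both jointly measurable. -/
structure IsInversePair {Ω : Type*} [MeasurableSpace Ω] (σ : ℝ≥0 → Ω → ℝ) (e : ℝ → Ω → ℝ≥0) :
    Prop where
  measurable_left : Measurable (Function.uncurry σ)
  measurable_right : Measurable (Function.uncurry e)
  nonneg : ∀ a ω, 0 ≤ σ a ω
  zero : ∀ ω, σ 0 ω = 0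
  tendsto : ∀ ω, Tendsto (fun a => σ a ω) atTop atTop
  continuous : ∀ ω, Continuous fun t => e t ω
  lt_iff : ∀ a t ω, 0 ≤ t → (σ a ω < t ↔ a < e t ω)

/-- The inverse is jointly measurable, being continuous in t and measurable in ω. Joint
measurability of S is then read off from {S_a < t} = {a < E_t}. -/
theorem IsInversePair.of_isRegularPath {Ω : Type*} [MeasurableSpace Ω] {S : ℝ≥0 → Ω → ℝ}
    (hm : ∀ t, Measurable (S t)) (h : ∀ ω, IsRegularPath fun t => S t ω) :
    IsInversePair S fun t ω => inverseSubordinator S (max t 0) ω := by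
  have he : Measurable (Function.uncurry fun (t : ℝ) ω => inverseSubordinator S (max t 0) ω) := by
    refine measurable_uncurry_of_continuous_of_measurable (fun ω => (h ω).continuous_inverse)
      fun t => measurable_of_Iic fun a => ?_
    have : (fun ω => inverseSubordinator S (max t 0) ω) ⁻¹' Iic a = {ω | max t 0 ≤ S a ω} := by
      ext ω
      exact (h ω).inverse_le_iff a
    rw [this]
    exact measurableSet_le measurable_const (hm a)
  refine ⟨measurable_of_Iio fun t => ?_, he, fun a ω => (h ω).nonneg a, fun ω => (h ω).zero,
    fun ω => (h ω).tendsto, fun ω => (h ω).continuous_inverse, fun a t ω ht => ?_⟩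
  · by_cases ht : 0 ≤ t
    · have : Function.uncurry S ⁻¹' Iio t
          = {p : ℝ≥0 × Ω | p.1 < inverseSubordinator S (max t 0) p.2} := by
        ext p
        simp only [mem_preimage, Function.uncurry, mem_Iio, mem_ofPred_eq, max_eq_left ht]
        exact (h p.2).lt_inverse_iff p.1
      rw [this]
      exact measurableSet_lt measurable_fst (he.comp (measurable_const.prodMk measurable_snd))
    · have : Function.uncurry S ⁻¹' Iio t = ∅ := by
        ext p
        simp only [mem_preimage, Function.uncurry, mem_Iio, mem_empty_iff_false, iff_false, not_lt]
        exact (not_le.1 ht).le.trans ((h p.2).nonneg p.1)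
      rw [this]
      exact MeasurableSet.empty
  · simp only [max_eq_left ht]
    exact (h ω).lt_inverse_iff a

theorem IsDriftlessSubordinator.exists_isInversePair {Ω : Type*} [MeasurableSpace Ω]
    {S : ℝ≥0 → Ω → ℝ} {ν : Measure ℝ} {Pr : Measure Ω} [IsProbabilityMeasure Pr]
    (hS : IsDriftlessSubordinator S ν Pr) (hν : ν (Ioi 0) = ∞) :
    ∃ (σ : ℝ≥0 → Ω → ℝ) (e : ℝ → Ω → ℝ≥0), IsInversePair σ e ∧
      (∀ (a : ℝ≥0) (l : ℝ), 0 < l →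
        ∫ ω, Real.exp (-(l * σ a ω)) ∂Pr = Real.exp (-(a * laplaceExponent ν l))) ∧
      ∀ᵐ ω ∂Pr, ∀ t, 0 ≤ t → inverseSubordinator S t ω = e t ω := by
  obtain ⟨S', hm, hr, hae⟩ := hS.exists_regular_modification hν
  refine ⟨S', _, .of_isRegularPath hm hr, fun a l hl => ?_, ?_⟩
  · rw [laplaceExponent, ← hS.laplace a l hl]
    refine integral_congr_ae ?_
    filter_upwards [hae] with ω h
    rw [h]
  · filter_upwards [hae] with ω h t ht
    simp only [inverseSubordinator, h, max_eq_left ht]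

theorem setLIntegral_exp_neg_mul {l x : ℝ} (hl : 0 < l) (hx : 0 ≤ x) :
    ∫⁻ s in Ioc 0 x, ENNReal.ofReal (Real.exp (-(l * s)))
      = ENNReal.ofReal ((1 - Real.exp (-(l * x))) / l) := by
  rw [← integral_exp_neg_mul hl.ne', intervalIntegral.integral_of_le hx, ofReal_integral_eq_lintegral_ofReal]
  · exact (Continuous.integrableOn_Icc (by fun_prop)).mono_set Ioc_subset_Icc_self
  · exact ae_of_all _ fun s => (Real.exp_pos _).le

/-! ### The convolution identity for the potential measure -/

section Potential

variable {Ω : Type*} [MeasurableSpace Ω]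

/-- The measure `P(σ_r ≥ s) ds` on `(0,∞)`. -/
noncomputable def survivalMeasure (σ : ℝ≥0 → Ω → ℝ) (Pr : Measure Ω) (r : ℝ≥0) : Measure ℝ :=
  (((volume.restrict (Ioi (0 : ℝ))).prod Pr).restrict {p | p.1 ≤ σ r p.2}).map Prod.fst

/-- The measure `w(x) dx` on `(0,∞)`. -/
noncomputable def tailMeasure (ν : Measure ℝ) : Measure ℝ :=
  (volume.restrict (Ioi (0 : ℝ))).withDensity fun x => ENNReal.ofReal (levyTail ν x)

instance (ν : Measure ℝ) : SFinite (tailMeasure ν) := by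
  unfold tailMeasure; infer_instance

/-- The convolution of `w(x) dx` with the potential measure of `σ` up to time `r`. -/
noncomputable def potentialTailMeasure (σ : ℝ≥0 → Ω → ℝ) (Pr : Measure Ω) (ν : Measure ℝ)
    (r : ℝ≥0) : Measure ℝ :=
  (((volume.restrict (Ioc (0 : ℝ) r)).prod Pr).prod (tailMeasure ν)).map
    fun q => σ q.1.1.toNNReal q.1.2 + q.2

variable {σ : ℝ≥0 → Ω → ℝ} {e : ℝ → Ω → ℝ≥0} {Pr : Measure Ω} [IsProbabilityMeasure Pr]
  {ν : Measure ℝ}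

theorem IsInversePair.measurable_apply (h : IsInversePair σ e) (a : ℝ≥0) : Measurable (σ a) :=
  h.measurable_left.comp measurable_prodMk_left

theorem IsInversePair.measurable_toNNReal (h : IsInversePair σ e) :
    Measurable fun p : ℝ × Ω => σ p.1.toNNReal p.2 :=
  h.measurable_left.comp (measurable_fst.real_toNNReal.prodMk measurable_snd)

theorem IsInversePair.measurable_sum (h : IsInversePair σ e) :
    Measurable fun q : (ℝ × Ω) × ℝ => σ q.1.1.toNNReal q.1.2 + q.2 :=
  (h.measurable_toNNReal.comp measurable_fst).add measurable_snd

theorem IsInversePair.measurableSet_le (h : IsInversePair σ e) (r : ℝ≥0) :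
    MeasurableSet {p : ℝ × Ω | p.1 ≤ σ r p.2} :=
  _root_.measurableSet_le measurable_fst ((h.measurable_apply r).comp measurable_snd)

theorem setLIntegral_Ioi_indicator_le (F : ℝ → ℝ≥0∞) (x : ℝ) :
    ∫⁻ s in Ioi (0 : ℝ), {s | s ≤ x}.indicator F s = ∫⁻ s in Ioc 0 x, F s := by
  change ∫⁻ s in Ioi (0 : ℝ), (Iic x).indicator F s = _
  rw [lintegral_indicator measurableSet_Iic, Measure.restrict_restrict measurableSet_Iic,
    inter_comm, ← Ioi_inter_Iic]

theorem lintegral_survivalMeasure (h : IsInversePair σ e) (r : ℝ≥0) {F : ℝ → ℝ≥0∞}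
    (hF : Measurable F) :
    ∫⁻ s, F s ∂survivalMeasure σ Pr r = ∫⁻ ω, (∫⁻ s in Ioc 0 (σ r ω), F s) ∂Pr := by
  rw [survivalMeasure, lintegral_map hF measurable_fst,
    ← lintegral_indicator (h.measurableSet_le r), lintegral_prod_symm]
  · refine lintegral_congr fun ω => ?_
    rw [← setLIntegral_Ioi_indicator_le]
    rfl
  · exact ((hF.comp measurable_fst).indicator (h.measurableSet_le r)).aemeasurable

/-- By Tonelli the left side is E ∫_0^{σ_r} exp(-ls) ds = (1 - E exp(-lσ_r))/l. -/
theorem laplace_survivalMeasure (h : IsInversePair σ e) (r : ℝ≥0) {l : ℝ} (hl : 0 < l)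
    {φ : ℝ} (hφ : ∫ ω, Real.exp (-(l * σ r ω)) ∂Pr = Real.exp (-(r * φ))) :
    ∫⁻ s, ENNReal.ofReal (Real.exp (-(l * s))) ∂survivalMeasure σ Pr r
      = ENNReal.ofReal ((1 - Real.exp (-(r * φ))) / l) := by
  rw [lintegral_survivalMeasure h r (by fun_prop)]
  simp_rw [setLIntegral_exp_neg_mul hl (h.nonneg r _)]
  have hm := h.measurable_apply r
  have hle : ∀ ω, Real.exp (-(l * σ r ω)) ≤ 1 := fun ω =>
    Real.exp_le_one_iff.2 (by nlinarith [h.nonneg r ω])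
  have hint : Integrable (fun ω => Real.exp (-(l * σ r ω))) Pr := by
    refine (integrable_const (1 : ℝ)).mono' (by fun_prop) (ae_of_all _ fun ω => ?_)
    rw [Real.norm_of_nonneg (Real.exp_pos _).le]
    exact hle ω
  have hint' : Integrable (fun ω => (1 - Real.exp (-(l * σ r ω))) / l) Pr :=
    ((integrable_const 1).sub hint).div_const l
  rw [← ofReal_integral_eq_lintegral_ofReal hint'
    (ae_of_all _ fun ω => div_nonneg (sub_nonneg.2 (hle ω)) hl.le), integral_div,
    integral_sub (integrable_const 1) hint, hφ]
  simp

/-- The transform of a convolution is a product, here of ∫_0^r exp(-aφ(l)) da = (1 -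
exp(-rφ(l)))/φ(l) and φ(l)/l; the factor φ(l) cancels. -/
theorem laplace_potentialTailMeasure (h : IsInversePair σ e) (r : ℝ≥0)
    (hν : ∫⁻ s in Ioi (0 : ℝ), ENNReal.ofReal (min 1 s) ∂ν < ∞) {l : ℝ} (hl : 0 < l)
    (hpos : 0 < laplaceExponent ν l)
    (hφ : ∀ a : ℝ≥0, ∫ ω, Real.exp (-(l * σ a ω)) ∂Pr = Real.exp (-(a * laplaceExponent ν l))) :
    ∫⁻ s, ENNReal.ofReal (Real.exp (-(l * s))) ∂potentialTailMeasure σ Pr ν r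
      = ENNReal.ofReal ((1 - Real.exp (-(r * laplaceExponent ν l))) / l) := by
  have hme : Measurable fun p : ℝ × Ω =>
      ENNReal.ofReal (Real.exp (-(l * σ p.1.toNNReal p.2))) :=
    (Real.measurable_exp.comp (h.measurable_toNNReal.const_mul l).neg).ennreal_ofReal
  have hW : ∫⁻ x, ENNReal.ofReal (Real.exp (-(l * x))) ∂tailMeasure ν
      = ENNReal.ofReal (laplaceExponent ν l / l) := by
    rw [← lintegral_exp_mul_levyTail hν hl, tailMeasure, lintegral_withDensity_eq_lintegral_mul _
      measurable_levyTail.ennreal_ofReal (by fun_prop)]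
    simp only [Pi.mul_apply, mul_comm]
  have hE : ∀ a : ℝ≥0, ∫⁻ ω, ENNReal.ofReal (Real.exp (-(l * σ a ω))) ∂Pr
      = ENNReal.ofReal (Real.exp (-(laplaceExponent ν l * a))) := by
    intro a
    have hma := h.measurable_apply a
    rw [← ofReal_integral_eq_lintegral_ofReal _ (ae_of_all _ fun ω => (Real.exp_pos _).le), hφ,
      mul_comm]
    refine (integrable_const (1 : ℝ)).mono' (by fun_prop) (ae_of_all _ fun ω => ?_)
    rw [Real.norm_of_nonneg (Real.exp_pos _).le]
    exact Real.exp_le_one_iff.2 (by nlinarith [h.nonneg a ω])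
  rw [potentialTailMeasure, lintegral_map (by fun_prop) h.measurable_sum]
  have hsplit : ∀ q : (ℝ × Ω) × ℝ, ENNReal.ofReal (Real.exp (-(l * (σ q.1.1.toNNReal q.1.2 + q.2))))
      = ENNReal.ofReal (Real.exp (-(l * σ q.1.1.toNNReal q.1.2)))
        * ENNReal.ofReal (Real.exp (-(l * q.2))) := by
    intro q
    rw [← ENNReal.ofReal_mul (Real.exp_pos _).le, ← Real.exp_add]
    congr 2
    ring
  simp_rw [hsplit]
  rw [lintegral_prod_mul (f := fun p : ℝ × Ω => ENNReal.ofReal (Real.exp (-(l * σ p.1.toNNReal p.2))))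
    (g := fun x => ENNReal.ofReal (Real.exp (-(l * x)))) hme.aemeasurable (by fun_prop), hW,
    lintegral_prod _ hme.aemeasurable]
  simp_rw [hE]
  have : ∫⁻ a in Ioc (0 : ℝ) r,
      ENNReal.ofReal (Real.exp (-(laplaceExponent ν l * (a.toNNReal : ℝ))))
      = ∫⁻ a in Ioc (0 : ℝ) r, ENNReal.ofReal (Real.exp (-(laplaceExponent ν l * a))) := by
    refine setLIntegral_congr_fun measurableSet_Ioc fun a ha => ?_
    rw [Real.coe_toNNReal _ ha.1.le]
  rw [this, setLIntegral_exp_neg_mul hpos r.coe_nonneg, ← ENNReal.ofReal_mul]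
  · congr 1
    rw [mul_comm (laplaceExponent ν l) (r : ℝ)]
    field_simp
  · refine div_nonneg (sub_nonneg.2 (Real.exp_le_one_iff.2 ?_)) hpos.le
    have : (0 : ℝ) ≤ laplaceExponent ν l * r := by positivity
    simpa using this

theorem survivalMeasure_eq_potentialTailMeasure (h : IsInversePair σ e)
    (hν : ∫⁻ s in Ioi (0 : ℝ), ENNReal.ofReal (min 1 s) ∂ν < ∞) (hinf : ν (Ioi 0) = ∞)
    (hφ : ∀ (a : ℝ≥0) (l : ℝ), 0 < l →
      ∫ ω, Real.exp (-(l * σ a ω)) ∂Pr = Real.exp (-(a * laplaceExponent ν l))) (r : ℝ≥0) :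
    survivalMeasure σ Pr r = potentialTailMeasure σ Pr ν r := by
  refine Measure.ext_of_laplace (fun l hl => ?_) fun l hl => ?_
  · rw [laplace_survivalMeasure h r hl (hφ r l hl)]
    exact ENNReal.ofReal_lt_top
  · rw [laplace_survivalMeasure h r hl (hφ r l hl), laplace_potentialTailMeasure h r hν hl
      (laplaceExponent_pos hν hinf hl) fun a => hφ a l hl]

/-- The total mass is E σ_r, which may be infinite; below t it is at most the length of (0, t]. -/
theorem survivalMeasure_Iic_lt_top (h : IsInversePair σ e) (r : ℝ≥0) (t : ℝ) :
    survivalMeasure σ Pr r (Iic t) < ∞ := by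
  rw [← lintegral_indicator_one measurableSet_Iic,
    lintegral_survivalMeasure h r (measurable_one.indicator measurableSet_Iic)]
  calc ∫⁻ ω, (∫⁻ s in Ioc 0 (σ r ω), (Iic t).indicator 1 s) ∂Pr
      ≤ ∫⁻ _, ENNReal.ofReal t ∂Pr := by
        refine lintegral_mono fun ω => ?_
        rw [lintegral_indicator_one measurableSet_Iic, Measure.restrict_apply measurableSet_Iic]
        calc volume (Iic t ∩ Ioc 0 (σ r ω)) ≤ volume (Ioc 0 t) :=
              measure_mono fun s hs => ⟨hs.2.1, hs.1⟩
          _ = ENNReal.ofReal t := by simp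
    _ < ∞ := by simp

end Potential

/-! ### Two ways of testing the convolution identity -/

section Potential

variable {Ω : Type*} [MeasurableSpace Ω] {σ : ℝ≥0 → Ω → ℝ} {e : ℝ → Ω → ℝ≥0} {Pr : Measure Ω}
  [IsProbabilityMeasure Pr] {ν : Measure ℝ}

theorem integral_tailMeasure (F : ℝ → ℝ) :
    ∫ x, F x ∂tailMeasure ν = ∫ x in Ioi 0, levyTail ν x * F x := by
  rw [tailMeasure, integral_withDensity_eq_integral_toReal_smul
    measurable_levyTail.ennreal_ofReal (ae_of_all _ fun x => ENNReal.ofReal_lt_top)]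
  simp only [ENNReal.toReal_ofReal (levyTail_nonneg _), smul_eq_mul]

theorem integral_survivalMeasure (h : IsInversePair σ e) (r : ℝ≥0) {F : ℝ → ℝ}
    (hF : Integrable F (survivalMeasure σ Pr r)) :
    ∫ s, F s ∂survivalMeasure σ Pr r = ∫ ω, (∫ s in Ioc 0 (σ r ω), F s) ∂Pr := by
  have hF' := hF
  rw [survivalMeasure, integrable_map_measure hF.1 measurable_fst.aemeasurable] at hF'
  rw [survivalMeasure, integral_map measurable_fst.aemeasurable hF.1,
    ← integral_indicator (h.measurableSet_le r), integral_prod_symm]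
  · refine integral_congr_ae (ae_of_all _ fun ω => ?_)
    change ∫ s in Ioi (0 : ℝ), (Iic (σ r ω)).indicator F s = _
    rw [integral_indicator measurableSet_Iic, Measure.restrict_restrict measurableSet_Iic,
      inter_comm, Ioi_inter_Iic]
  · exact (integrable_indicator_iff (h.measurableSet_le r)).2 hF'

theorem integral_potentialTailMeasure (h : IsInversePair σ e) (r : ℝ≥0) {F : ℝ → ℝ}
    (hF : Integrable F (potentialTailMeasure σ Pr ν r)) :
    ∫ s, F s ∂potentialTailMeasure σ Pr ν r = ∫ a in Ioc (0 : ℝ) r,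
      (∫ ω, (∫ x in Ioi 0, levyTail ν x * F (σ a.toNNReal ω + x)) ∂Pr) := by
  have hF' := hF
  rw [potentialTailMeasure, integrable_map_measure hF.1 h.measurable_sum.aemeasurable] at hF'
  rw [potentialTailMeasure, integral_map h.measurable_sum.aemeasurable hF.1]
  refine (integral_prod _ hF').trans ((integral_prod _ hF'.integral_prod_left).trans ?_)
  simp only [Function.comp_apply, integral_tailMeasure]

/-- If `w * c = K` on `(0,∞)`, then the potential operators of `σ` up to time `r` turn `K` into the
increment of the primitive of `c`. -/
theorem integral_primitive_sub_eq (h : IsInversePair σ e)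
    (hν : ∫⁻ s in Ioi (0 : ℝ), ENNReal.ofReal (min 1 s) ∂ν < ∞) (hinf : ν (Ioi 0) = ∞)
    (hφ : ∀ (a : ℝ≥0) (l : ℝ), 0 < l →
      ∫ ω, Real.exp (-(l * σ a ω)) ∂Pr = Real.exp (-(a * laplaceExponent ν l)))
    {c K : ℝ → ℝ} (hc : Continuous c) (hc0 : ∀ s ≤ 0, c s = 0) (hK0 : ∀ s ≤ 0, K s = 0)
    (hcK : ∀ t > 0, ∫ x in Ioc 0 t, levyTail ν x * c (t - x) = K t) (r : ℝ≥0) (t : ℝ) :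
    ∫ ω, (∫ s in Ioc 0 (σ r ω), c (t - s)) ∂Pr
      = ∫ a in Ioc (0 : ℝ) r, (∫ ω, K (t - σ a.toNNReal ω) ∂Pr) := by
  have hint : Integrable (fun z => c (t - z)) (survivalMeasure σ Pr r) := by
    obtain ⟨B, hB⟩ := (isCompact_Icc (a := 0) (b := t)).exists_bound_of_continuousOn hc.continuousOn
    have hg : Integrable ((Iic t).indicator fun _ => B) (survivalMeasure σ Pr r) := by
      rw [integrable_indicator_iff measurableSet_Iic]
      exact integrableOn_const (survivalMeasure_Iic_lt_top h r t).ne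
    refine hg.mono' (by fun_prop) ?_
    have hpos : ∀ᵐ z ∂survivalMeasure σ Pr r, 0 < z := by
      rw [ae_iff, ← lintegral_indicator_one (by simp only [not_lt]; exact measurableSet_Iic),
        lintegral_survivalMeasure h r (measurable_one.indicator
          (by simp only [not_lt]; exact measurableSet_Iic))]
      rw [lintegral_eq_zero_of_ae_eq_zero]
      refine ae_of_all _ fun ω => ?_
      refine setLIntegral_eq_zero measurableSet_Ioc fun s hs => ?_
      simp [hs.1]
    filter_upwards [hpos] with z hz
    by_cases hzt : z ≤ t
    · rw [indicator_of_mem (show z ∈ Iic t from hzt)]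
      exact hB _ ⟨by linarith, by linarith⟩
    · rw [hc0 _ (by linarith [not_le.1 hzt]), indicator_of_notMem (by simpa using hzt)]
      simp
  -- Both measures are tested on z ↦ c(t - z).
  have heq := survivalMeasure_eq_potentialTailMeasure h hν hinf hφ r
  rw [← integral_survivalMeasure h r hint, heq, integral_potentialTailMeasure h r (heq ▸ hint)]
  congr 1 with a
  congr 1 with ω
  -- The inner integral is (w * c)(y) = K(y), and both vanish when y ≤ 0.
  set y := t - σ a.toNNReal ω with hy
  have h1 : ∀ x, c (t - (σ a.toNNReal ω + x)) = c (y - x) := fun x => by rw [hy]; ring_nf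
  simp only [h1]
  rcases le_or_gt y 0 with hy0 | hy0
  · rw [hK0 y hy0]
    refine setIntegral_eq_zero_of_forall_eq_zero fun x hx => ?_
    rw [hc0 _ (by linarith [show (0 : ℝ) < x from hx]), mul_zero]
  · rw [← hcK y hy0]
    refine setIntegral_eq_of_subset_of_forall_sdiff_eq_zero measurableSet_Ioi
      Ioc_subset_Ioi_self fun x hx => ?_
    have hx1 : 0 < x := hx.1
    rw [hc0 _ (by_contra fun hcon => hx.2 ⟨hx1, by linarith⟩), mul_zero]

/-- The occupation measure of `e` up to time `t`. -/
noncomputable def occupationMeasure (e : ℝ → Ω → ℝ≥0) (Pr : Measure Ω) (t : ℝ) : Measure ℝ :=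
  ((volume.restrict (Ioo 0 t)).prod Pr).map fun p => (e p.1 p.2 : ℝ)

/-- The measure `(∫_0^t w(x) P(σ_a < t - x) dx) da` on `(0,∞)`. -/
noncomputable def potentialOccupationMeasure (σ : ℝ≥0 → Ω → ℝ) (Pr : Measure Ω) (ν : Measure ℝ)
    (t : ℝ) : Measure ℝ :=
  ((((volume.restrict (Ioi (0 : ℝ))).prod Pr).prod (tailMeasure ν)).restrict
    {q | σ q.1.1.toNNReal q.1.2 + q.2 < t}).map fun q => q.1.1

theorem IsInversePair.measurable_inverse (h : IsInversePair σ e) :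
    Measurable fun p : ℝ × Ω => (e p.1 p.2 : ℝ) :=
  measurable_coe_nnreal_real.comp h.measurable_right

/-- The masses of (-∞, r] on the two sides are the masses of (-∞, t) under the two measures of the
convolution identity, since e_s ≤ r exactly when s ≤ σ_r. -/
theorem occupationMeasure_eq (h : IsInversePair σ e)
    (hν : ∫⁻ s in Ioi (0 : ℝ), ENNReal.ofReal (min 1 s) ∂ν < ∞) (hinf : ν (Ioi 0) = ∞)
    (hφ : ∀ (a : ℝ≥0) (l : ℝ), 0 < l →
      ∫ ω, Real.exp (-(l * σ a ω)) ∂Pr = Real.exp (-(a * laplaceExponent ν l))) (t : ℝ) :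
    occupationMeasure e Pr t = potentialOccupationMeasure σ Pr ν t := by
  have hfin : IsFiniteMeasure (occupationMeasure e Pr t) := by
    unfold occupationMeasure; infer_instance
  have hA : MeasurableSet {q : (ℝ × Ω) × ℝ | σ q.1.1.toNNReal q.1.2 + q.2 < t} :=
    measurableSet_lt h.measurable_sum measurable_const
  refine Measure.ext_of_Iic _ _ fun r => ?_
  have hfst : Measurable fun q : (ℝ × Ω) × ℝ => q.1.1 := measurable_fst.fst
  rw [occupationMeasure, potentialOccupationMeasure,
    Measure.map_apply h.measurable_inverse measurableSet_Iic,
    Measure.map_apply hfst measurableSet_Iic, Measure.restrict_apply (hfst measurableSet_Iic)]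
  rcases lt_or_ge r 0 with hr | hr
  · have h1 : (fun p : ℝ × Ω => (e p.1 p.2 : ℝ)) ⁻¹' Iic r = ∅ := by
      ext p
      simp only [mem_preimage, mem_Iic, mem_empty_iff_false, iff_false, not_le]
      exact hr.trans_le (e p.1 p.2).2
    rw [h1, measure_empty]
    symm
    refine measure_mono_null (t := (Iic r ×ˢ univ) ×ˢ univ) (fun q hq => ⟨⟨hq.1, trivial⟩, trivial⟩) ?_
    rw [Measure.prod_prod, Measure.prod_prod, Measure.restrict_apply measurableSet_Iic]
    have : Iic r ∩ Ioi 0 = ∅ := by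
      ext x
      simp only [mem_inter_iff, mem_Iic, mem_Ioi, mem_empty_iff_false, iff_false, not_and, not_lt]
      intro hx
      linarith
    simp [this]
  · lift r to ℝ≥0 using hr
    have key := congrArg (fun m : Measure ℝ => m (Iio t))
      (survivalMeasure_eq_potentialTailMeasure h hν hinf hφ r)
    simp only [survivalMeasure, potentialTailMeasure] at key
    rw [Measure.map_apply measurable_fst measurableSet_Iio,
      Measure.map_apply h.measurable_sum measurableSet_Iio,
      Measure.restrict_apply (measurable_fst measurableSet_Iio)] at key
    have hvol : volume.restrict (Ioc (0 : ℝ) r)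
        = (volume.restrict (Ioi (0 : ℝ))).restrict (Iic (r : ℝ)) := by
      rw [Measure.restrict_restrict measurableSet_Iic, inter_comm, Ioi_inter_Iic]
    have hvol2 : volume.restrict (Ioo (0 : ℝ) t)
        = (volume.restrict (Ioi (0 : ℝ))).restrict (Iio t) := by
      rw [Measure.restrict_restrict measurableSet_Iio, inter_comm, Ioi_inter_Iio]
    have hL : ((volume.restrict (Ioo (0 : ℝ) t)).prod Pr)
          ((fun p : ℝ × Ω => (e p.1 p.2 : ℝ)) ⁻¹' Iic (r : ℝ))
        = ((volume.restrict (Ioi (0 : ℝ))).prod Pr) (Prod.fst ⁻¹' Iio t ∩ {p | p.1 ≤ σ r p.2}) := by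
      rw [hvol2, ← Measure.restrict_univ (μ := Pr), Measure.prod_restrict,
        Measure.restrict_apply (h.measurable_inverse measurableSet_Iic), Measure.restrict_univ]
      refine measure_congr ?_
      have hpos : ∀ᵐ p ∂((volume.restrict (Ioi (0 : ℝ))).prod Pr), 0 < p.1 :=
        Measure.quasiMeasurePreserving_fst.ae (ae_restrict_mem measurableSet_Ioi)
      filter_upwards [hpos] with p hp
      have := h.lt_iff r p.1 p.2 hp.le
      refine propext ?_
      change ((e p.1 p.2 : ℝ) ≤ r ∧ p.1 < t ∧ True) ↔ (p.1 < t ∧ p.1 ≤ σ r p.2)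
      rw [NNReal.coe_le_coe, ← not_lt (a := r), ← this, not_lt]
      tauto
    have hR : (((volume.restrict (Ioc (0 : ℝ) r)).prod Pr).prod (tailMeasure ν))
          ((fun q : (ℝ × Ω) × ℝ => σ q.1.1.toNNReal q.1.2 + q.2) ⁻¹' Iio t)
        = (((volume.restrict (Ioi (0 : ℝ))).prod Pr).prod (tailMeasure ν))
          ((fun q : (ℝ × Ω) × ℝ => q.1.1) ⁻¹' Iic (r : ℝ) ∩
            {q | σ q.1.1.toNNReal q.1.2 + q.2 < t}) := by
      rw [hvol, ← Measure.restrict_univ (μ := Pr), Measure.prod_restrict,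
        ← Measure.restrict_univ (μ := tailMeasure ν), Measure.prod_restrict,
        Measure.restrict_apply (h.measurable_sum measurableSet_Iio), Measure.restrict_univ,
        Measure.restrict_univ]
      congr 1
      ext q
      simp only [mem_inter_iff, mem_preimage, mem_prod, mem_univ, and_true, mem_ofPred_eq, mem_Iio]
      tauto
    rw [hL, key, hR]

/-- If `η' = k`, then `∫_0^t E k(e_s) ds = ∫_0^t w(x) E[η(e_{t-x}) - η(0)] dx`. -/
theorem integral_comp_inverse_eq (h : IsInversePair σ e)
    (hν : ∫⁻ s in Ioi (0 : ℝ), ENNReal.ofReal (min 1 s) ∂ν < ∞) (hinf : ν (Ioi 0) = ∞)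
    (hφ : ∀ (a : ℝ≥0) (l : ℝ), 0 < l →
      ∫ ω, Real.exp (-(l * σ a ω)) ∂Pr = Real.exp (-(a * laplaceExponent ν l)))
    {k η : ℝ → ℝ} (hk : Continuous k) {B : ℝ} (hB : ∀ a, |k a| ≤ B)
    (hη : ∀ r ≥ 0, ∫ a in Ioc 0 r, k a = η r - η 0) (t : ℝ) :
    ∫ s in Ioc 0 t, (∫ ω, k (e s ω) ∂Pr)
      = ∫ x in Ioc 0 t, levyTail ν x * ∫ ω, (η (e (t - x) ω) - η 0) ∂Pr := by
  have hA : MeasurableSet {q : (ℝ × Ω) × ℝ | σ q.1.1.toNNReal q.1.2 + q.2 < t} :=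
    measurableSet_lt h.measurable_sum measurable_const
  have hfst : Measurable fun q : (ℝ × Ω) × ℝ => q.1.1 := measurable_fst.fst
  have heq := occupationMeasure_eq h hν hinf hφ t
  have hfin : IsFiniteMeasure (occupationMeasure e Pr t) := by
    unfold occupationMeasure; infer_instance
  have hint : Integrable k (occupationMeasure e Pr t) :=
    (integrable_const B).mono' hk.aestronglyMeasurable (ae_of_all _ hB)
  have h1 : ∫ a, k a ∂occupationMeasure e Pr t = ∫ s in Ioc 0 t, (∫ ω, k (e s ω) ∂Pr) := by
    have hint' := hint
    rw [occupationMeasure, integrable_map_measure hint.1 h.measurable_inverse.aemeasurable] at hint'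
    rw [occupationMeasure, integral_map h.measurable_inverse.aemeasurable hint.1,
      integral_Ioc_eq_integral_Ioo]
    exact integral_prod _ hint'
  rw [← h1, heq]
  -- The occupation measure is finite and k is bounded; integrability on the triple product is
  -- inherited through the equality of measures.
  rw [heq] at hint
  have hint' := hint
  rw [potentialOccupationMeasure, integrable_map_measure hint.1 hfst.aemeasurable] at hint'
  rw [potentialOccupationMeasure, integral_map hfst.aemeasurable hint.1,
    ← integral_indicator hA]
  have hind := (integrable_indicator_iff hA).2 hint'
  refine (integral_prod_symm _ hind).trans ?_
  have hfib : ∀ᵐ x ∂tailMeasure ν, ∫ p, {q : (ℝ × Ω) × ℝ | σ q.1.1.toNNReal q.1.2 + q.2 < t}.indicator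
      (k ∘ fun q => q.1.1) (p, x) ∂((volume.restrict (Ioi (0 : ℝ))).prod Pr)
      = (Iio t).indicator (fun x => ∫ ω, (η (e (t - x) ω) - η 0) ∂Pr) x := by
    filter_upwards [hind.prod_left_ae] with x hx
    by_cases hxt : x < t
    · rw [indicator_of_mem (show x ∈ Iio t from hxt)]
      refine (integral_prod_symm _ hx).trans (integral_congr_ae (ae_of_all _ fun ω => ?_))
      -- For fixed ω and x < t, the section σ_a + x < t is a < e_{t-x}, so k is integrated over (0,
      -- e_{t-x}).
      have h2 : ∫ a in Ioi (0 : ℝ), {q : (ℝ × Ω) × ℝ | σ q.1.1.toNNReal q.1.2 + q.2 < t}.indicator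
          (k ∘ fun q => q.1.1) ((a, ω), x)
          = ∫ a in Ioi (0 : ℝ), (Iio (e (t - x) ω : ℝ)).indicator k a := by
        refine setIntegral_congr_fun measurableSet_Ioi fun a ha => ?_
        have h3 := h.lt_iff a.toNNReal (t - x) ω (by linarith)
        rw [← NNReal.coe_lt_coe, Real.coe_toNNReal a (le_of_lt ha)] at h3
        have h4 : ((a, ω), x) ∈ {q : (ℝ × Ω) × ℝ | σ q.1.1.toNNReal q.1.2 + q.2 < t}
            ↔ a ∈ Iio (e (t - x) ω : ℝ) := by
          change σ a.toNNReal ω + x < t ↔ _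
          rw [← lt_sub_iff_add_lt]
          exact h3
        classical
        simp only [indicator_apply, h4, Function.comp_apply]
      refine h2.trans ?_
      rw [integral_indicator measurableSet_Iio, Measure.restrict_restrict measurableSet_Iio,
        inter_comm, Ioi_inter_Iio, ← integral_Ioc_eq_integral_Ioo, hη _ (e (t - x) ω).coe_nonneg]
    · rw [indicator_of_notMem (by simpa using hxt)]
      refine integral_eq_zero_of_ae (ae_of_all _ fun p => indicator_of_notMem (fun h5 => hxt ?_) _)
      have h6 : σ p.1.toNNReal p.2 + x < t := h5
      linarith [h.nonneg p.1.toNNReal p.2]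
  refine (integral_congr_ae hfib).trans ?_
  rw [integral_tailMeasure, integral_Ioc_eq_integral_Ioo, ← Ioi_inter_Iio, inter_comm,
    ← Measure.restrict_restrict measurableSet_Iio, ← integral_indicator measurableSet_Iio]
  refine integral_congr_ae (ae_of_all _ fun x => ?_)
  by_cases hxt : x ∈ Iio t <;> simp [hxt]

end Potential

/-! ### Symmetric contraction semigroups on a Hilbert space -/

section Semigroup

variable {H : Type*} [NormedAddCommGroup H] [InnerProductSpace ℝ H]

/-- A strongly continuous semigroup of symmetric linear contractions of a Hilbert space. -/
structure IsSymmetricSemigroup (T : ℝ≥0 → H → H) : Prop where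
  map_add : ∀ t x y, T t (x + y) = T t x + T t y
  map_smul : ∀ t (c : ℝ) x, T t (c • x) = c • T t x
  norm_le : ∀ t x, ‖T t x‖ ≤ ‖x‖
  zero : ∀ x, T 0 x = x
  comp : ∀ s t x, T (s + t) x = T s (T t x)
  symm : ∀ t x y, inner ℝ (T t x) y = inner ℝ x (T t y)
  tendsto : ∀ x, Tendsto (fun t => T t x) (𝓝[>] 0) (𝓝 x)

/-- `g` lies in the domain of the generator of `T`, with image `h`. -/
def IsGenerator (T : ℝ≥0 → H → H) (g h : H) : Prop :=
  Tendsto (fun t : ℝ≥0 => (t : ℝ)⁻¹ • (T t g - g)) (𝓝[>] 0) (𝓝 h)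

namespace IsSymmetricSemigroup

variable {T : ℝ≥0 → H → H} (hT : IsSymmetricSemigroup T)
include hT

/-- The operators of the semigroup as continuous linear maps. -/
noncomputable def toCLM (t : ℝ≥0) : H →L[ℝ] H :=
  LinearMap.mkContinuous ⟨⟨T t, hT.map_add t⟩, hT.map_smul t⟩ 1 fun x => by
    simpa using hT.norm_le t x

theorem toCLM_apply (t : ℝ≥0) (x : H) : hT.toCLM t x = T t x := rfl

theorem map_sub (t : ℝ≥0) (x y : H) : T t (x - y) = T t x - T t y :=
  (hT.toCLM t).map_sub x y

/-- Contractivity gives ‖T_s x - T_r x‖ ≤ ‖x - T_{r-s} x‖ for s ≤ r, so continuity at 0 controls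
both sides of every time. -/
theorem continuous_orbit (x : H) : Continuous fun t => T t x := by
  rw [Metric.continuous_iff]
  intro t ε hε
  obtain ⟨δ, hδ, h⟩ := (Metric.tendsto_nhdsWithin_nhds.1 (hT.tendsto x)) ε hε
  have key : ∀ s r : ℝ≥0, s ≤ r → dist s r < δ → dist (T s x) (T r x) < ε := by
    intro s r hsr hd
    rcases hsr.eq_or_lt with rfl | hlt
    · simpa using hε
    · have h1 := h (tsub_pos_of_lt hlt) (by
        rw [NNReal.dist_eq] at hd ⊢
        rw [NNReal.coe_sub hsr, NNReal.coe_zero, sub_zero, abs_sub_comm]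
        exact hd)
      rw [← add_tsub_cancel_of_le hsr, hT.comp, dist_comm, dist_eq_norm, ← hT.map_sub]
      exact (hT.norm_le _ _).trans_lt (by rwa [← dist_eq_norm])
  refine ⟨δ, hδ, fun s hs => ?_⟩
  rcases le_total s t with h1 | h1
  · exact key s t h1 hs
  · rw [dist_comm] at hs ⊢
    exact key t s h1 hs

theorem continuous_orbit_real (x : H) : Continuous fun t : ℝ => T t.toNNReal x :=
  (hT.continuous_orbit x).comp continuous_real_toNNReal

theorem commute (s t : ℝ≥0) (x : H) : T s (T t x) = T t (T s x) := by
  rw [← hT.comp, ← hT.comp, add_comm]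

theorem isGenerator_map {g h : H} (hg : IsGenerator T g h) (r : ℝ≥0) :
    IsGenerator T (T r g) (T r h) := by
  have h1 := ((hT.toCLM r).continuous.tendsto h).comp hg
  refine h1.congr fun t => ?_
  simp only [Function.comp_apply, hT.toCLM_apply, hT.map_smul, hT.map_sub, hT.commute r t]

/-- Only the right derivative comes directly from the definition of the generator; it suffices for
the fundamental theorem of calculus and for the constancy argument. -/
theorem tendsto_slope {g h : H} (hg : IsGenerator T g h) {r : ℝ} (hr : 0 ≤ r) :
    Tendsto (fun y : ℝ => (y - r)⁻¹ • (T y.toNNReal g - T r.toNNReal g)) (𝓝[>] r)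
      (𝓝 (T r.toNNReal h)) := by
  have h1 : Tendsto (fun y : ℝ => (y - r).toNNReal) (𝓝[>] r) (𝓝[>] 0) := by
    rw [tendsto_nhdsWithin_iff]
    constructor
    · have : Tendsto (fun y : ℝ => (y - r).toNNReal) (𝓝 r) (𝓝 (r - r).toNNReal) :=
        (continuous_real_toNNReal.comp (continuous_id.sub continuous_const)).tendsto r
      rw [sub_self, Real.toNNReal_zero] at this
      exact this.mono_left nhdsWithin_le_nhds
    · filter_upwards [self_mem_nhdsWithin] with y hy
      exact Real.toNNReal_pos.2 (sub_pos.2 hy)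
  refine ((hT.isGenerator_map hg r.toNNReal).comp h1).congr' ?_
  filter_upwards [self_mem_nhdsWithin] with y hy
  have hy : r < y := hy
  have h2 : y.toNNReal = (y - r).toNNReal + r.toNNReal := by
    rw [← Real.toNNReal_add (sub_pos.2 hy).le hr, sub_add_cancel]
  rw [Function.comp_apply, Real.coe_toNNReal _ (sub_pos.2 hy).le, h2, hT.comp]

variable [CompleteSpace H]

theorem integral_generator {g h : H} (hg : IsGenerator T g h) {r : ℝ} (hr : 0 ≤ r) :
    ∫ a in (0 : ℝ)..r, T a.toNNReal h = T r.toNNReal g - g := by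
  have := intervalIntegral.integral_eq_sub_of_hasDeriv_right_of_le hr
    (f := fun a : ℝ => T a.toNNReal g) (f' := fun a => T a.toNNReal h)
    (hT.continuous_orbit_real g).continuousOn (fun a ha => ?_)
    ((hT.continuous_orbit_real h).intervalIntegrable _ _)
  · rw [this, Real.toNNReal_zero, hT.zero]
  · rw [hasDerivWithinAt_iff_tendsto_slope' (by simp)]
    exact hT.tendsto_slope hg ha.1.le

theorem integral_inner_generator {g h : H} (hg : IsGenerator T g h) (x : H) {r : ℝ}
    (hr : 0 ≤ r) : ∫ a in Ioc 0 r, inner ℝ x (T a.toNNReal h)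
      = inner ℝ x (T r.toNNReal g) - inner ℝ x g := by
  rw [← inner_sub_right, ← hT.integral_generator hg hr, intervalIntegral.integral_of_le hr,
    integral_inner]
  exact (hT.continuous_orbit_real h).integrableOn_Icc.mono_set Ioc_subset_Icc_self

/-- T_t shifts the interval of integration, so the increment is ∫_t^{b+t} - ∫_0^b, a difference of
primitives whose derivative at t = 0 is T_b x - x. -/
theorem isGenerator_integral (x : H) (b : ℝ≥0) :
    IsGenerator T (∫ a in (0 : ℝ)..b, T a.toNNReal x) (T b x - x) := by
  have hc := hT.continuous_orbit_real x
  have hi : ∀ p q : ℝ, IntervalIntegrable (fun a : ℝ => T a.toNNReal x) volume p q :=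
    fun p q => hc.intervalIntegrable p q
  have hder : HasDerivAt (fun t : ℝ => (∫ a in (0 : ℝ)..(b + t), T a.toNNReal x)
      - ∫ a in (0 : ℝ)..t, T a.toNNReal x) (T b x - x) 0 := by
    have h1 : HasDerivAt (fun t : ℝ => ∫ a in (0 : ℝ)..t, T a.toNNReal x)
        (T (b + 0 : ℝ).toNNReal x) (b + 0) := hc.integral_hasStrictDerivAt 0 (b + 0) |>.hasDerivAt
    have h2 : HasDerivAt (fun t : ℝ => ∫ a in (0 : ℝ)..t, T a.toNNReal x)
        (T (0 : ℝ).toNNReal x) 0 := (hc.integral_hasStrictDerivAt 0 0).hasDerivAt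
    have h3 := (h1.comp_const_add (b : ℝ) 0).fun_sub h2
    simpa [hT.zero] using h3
  have h4 := hder.tendsto_slope_zero_right
  have h5 : Tendsto (fun t : ℝ≥0 => (t : ℝ)) (𝓝[>] 0) (𝓝[>] 0) := by
    rw [tendsto_nhdsWithin_iff]
    refine ⟨(NNReal.continuous_coe.tendsto 0).mono_left nhdsWithin_le_nhds, ?_⟩
    filter_upwards [self_mem_nhdsWithin] with t ht using ht
  refine (h4.comp h5).congr fun t => ?_
  simp only [Function.comp_apply, zero_add, add_zero, intervalIntegral.integral_same, sub_zero]
  congr 1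
  have h6 : T t (∫ a in (0 : ℝ)..b, T a.toNNReal x) = ∫ a in (t : ℝ)..(b + t), T a.toNNReal x := by
    rw [← hT.toCLM_apply, ← (hT.toCLM t).intervalIntegral_comp_comm (hi 0 b)]
    have := intervalIntegral.integral_comp_add_right (a := 0) (b := (b : ℝ))
      (fun a : ℝ => T a.toNNReal x) (t : ℝ)
    rw [zero_add] at this
    rw [← this]
    refine intervalIntegral.integral_congr fun a ha => ?_
    rw [uIcc_of_le b.coe_nonneg] at ha
    simp only [hT.toCLM_apply]
    rw [← hT.comp, Real.toNNReal_add ha.1 t.coe_nonneg, Real.toNNReal_coe, add_comm]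
  rw [h6, ← intervalIntegral.integral_interval_sub_left (hi 0 (b + t)) (hi 0 t)]

/-- The averages t⁻¹ ∫_0^t T_a x da lie in the domain and tend to x. -/
theorem exists_isGenerator_near (x : H) {ε : ℝ} (hε : 0 < ε) :
    ∃ g h, IsGenerator T g h ∧ ‖x - g‖ < ε := by
  have hc := hT.continuous_orbit_real x
  have h1 : HasDerivAt (fun t : ℝ => ∫ a in (0 : ℝ)..t, T a.toNNReal x)
      (T (0 : ℝ).toNNReal x) 0 := (hc.integral_hasStrictDerivAt 0 0).hasDerivAt
  have h2 := h1.tendsto_slope_zero_right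
  rw [Real.toNNReal_zero, hT.zero] at h2
  obtain ⟨t, ht, ht0⟩ := ((h2.eventually (Metric.ball_mem_nhds x hε)).and self_mem_nhdsWithin).exists
  have ht0 : 0 < t := ht0
  have h3 := hT.isGenerator_integral x t.toNNReal
  refine ⟨t⁻¹ • ∫ a in (0 : ℝ)..t, T a.toNNReal x, t⁻¹ • (T t.toNNReal x - x), ?_, ?_⟩
  · rw [Real.coe_toNNReal _ ht0.le] at h3
    refine (h3.const_smul t⁻¹).congr fun s => ?_
    rw [hT.map_smul, ← smul_sub, smul_comm]
  · simpa [dist_eq_norm, norm_sub_rev] using ht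

theorem eq_zero_of_inner_domain {z : H} (hz : ∀ g h, IsGenerator T g h → inner ℝ z g = 0) :
    z = 0 := by
  by_contra hne
  obtain ⟨g, h, hg, hlt⟩ := hT.exists_isGenerator_near z (norm_pos_iff.2 hne)
  have h1 : inner ℝ z (z - g) = ‖z‖ ^ 2 := by
    rw [inner_sub_right, hz g h hg, sub_zero, real_inner_self_eq_norm_sq]
  have h2 := real_inner_le_norm z (z - g)
  have h3 := norm_pos_iff.2 hne
  nlinarith

/-- A bounded weak solution of the backward equation `V' = -L V` vanishing at infinity is zero. -/
theorem eq_zero_of_backward {V : ℝ≥0 → H} {C : ℝ} (hVm : AEStronglyMeasurable (fun r : ℝ => V r.toNNReal))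
    (hC : ∀ r, ‖V r‖ ≤ C) (hV0 : Tendsto V atTop (𝓝 0))
    (hV : ∀ g h, IsGenerator T g h → ∀ r : ℝ≥0,
      inner ℝ (V 0) g - inner ℝ (V r) g = ∫ a in (0 : ℝ)..r, inner ℝ (V a.toNNReal) h) :
    V 0 = 0 := by
  have hii : ∀ (x : H) (p q : ℝ),
      IntervalIntegrable (fun a : ℝ => inner ℝ (V a.toNNReal) x) volume p q := by
    intro x p q
    refine (intervalIntegrable_const (c := C * ‖x‖)).mono_fun
      (hVm.inner aestronglyMeasurable_const).restrict (ae_of_all _ fun a => ?_)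
    refine (norm_inner_le_norm _ _).trans (le_trans ?_ (le_abs_self _))
    gcongr
    exact hC _
  have hV' : ∀ g h, IsGenerator T g h → ∀ r : ℝ, 0 ≤ r →
      inner ℝ (V r.toNNReal) g = inner ℝ (V 0) g - ∫ a in (0 : ℝ)..r, inner ℝ (V a.toNNReal) h := by
    intro g h hg r hr
    have := hV g h hg r.toNNReal
    rw [Real.coe_toNNReal r hr] at this
    linarith
  have hcont_dom : ∀ g h, IsGenerator T g h →
      ContinuousOn (fun r : ℝ => inner ℝ (V r.toNNReal) g) (Ici 0) := by
    intro g h hg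
    have h1 : Continuous fun r : ℝ =>
        inner ℝ (V 0) g - ∫ a in (0 : ℝ)..r, inner ℝ (V a.toNNReal) h :=
      continuous_const.sub (intervalIntegral.continuous_primitive (hii h) 0)
    exact h1.continuousOn.congr fun r hr => hV' g h hg r hr
  -- Weak continuity passes from the dense domain to every x, uniformly in r because V is bounded.
  have hcontOn : ∀ x : H, ContinuousOn (fun r : ℝ => inner ℝ (V r.toNNReal) x) (Ici 0) := by
    intro x
    refine continuousOn_of_uniform_approx_of_continuousOn fun u hu => ?_
    obtain ⟨ε, hε, hεu⟩ := Metric.mem_uniformity_dist.1 hu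
    have hC0 : 0 ≤ C := (norm_nonneg _).trans (hC 0)
    obtain ⟨g, h, hg, hlt⟩ := hT.exists_isGenerator_near x (show 0 < ε / (C + 1) by positivity)
    refine ⟨_, hcont_dom g h hg, fun r _ => hεu ?_⟩
    rw [Real.dist_eq, ← inner_sub_right]
    refine (abs_real_inner_le_norm _ _).trans_lt ?_
    have h1 : ‖V r.toNNReal‖ * ‖x - g‖ ≤ C * ‖x - g‖ := by gcongr; exact hC _
    rw [lt_div_iff₀ (by positivity)] at hlt
    nlinarith [norm_nonneg (x - g)]
  have hcont : ∀ x : H, Continuous fun r : ℝ => inner ℝ (V r.toNNReal) x := by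
    intro x
    have h1 : Continuous fun r : ℝ => inner ℝ (V (max r 0).toNNReal) x :=
      (hcontOn x).comp_continuous (continuous_id.max continuous_const) fun r => le_max_right r 0
    refine h1.congr fun r => ?_
    congr 2
    rcases le_total r 0 with hr | hr
    · rw [max_eq_right hr, Real.toNNReal_of_nonpos hr, Real.toNNReal_zero]
    · rw [max_eq_left hr]
  -- V is only weakly continuous, but bounded, so it pairs continuously with norm-convergent
  -- vectors.
  have hpair : ∀ (l : Filter ℝ) (r : ℝ) (z : ℝ → H) (z₀ : H), l ≤ 𝓝 r → Tendsto z l (𝓝 z₀) →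
      Tendsto (fun y => inner ℝ (V y.toNNReal) (z y)) l (𝓝 (inner ℝ (V r.toNNReal) z₀)) := by
    intro l r z z₀ hl hz
    have h1 : Tendsto (fun y => inner ℝ (V y.toNNReal) (z y - z₀)) l (𝓝 0) := by
      refine squeeze_zero_norm (fun y => (norm_inner_le_norm _ _).trans
        (mul_le_mul_of_nonneg_right (hC _) (norm_nonneg _))) ?_
      simpa using ((tendsto_iff_norm_sub_tendsto_zero.1 hz).const_mul C)
    have h2 := h1.add (((hcont z₀).tendsto r).mono_left hl)
    rw [zero_add] at h2
    refine h2.congr fun y => ?_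
    rw [← inner_add_right, sub_add_cancel]
  refine hT.eq_zero_of_inner_domain fun g h hg => ?_
  -- Product rule: ⟨V, T_r Lg⟩ from the second factor cancels -⟨V, L T_r g⟩ from the first. The
  -- first factor is differentiated against the fixed domain element T_y g.
  have hconst : ∀ r : ℝ, 0 ≤ r → inner ℝ (V r.toNNReal) (T r.toNNReal g) = inner ℝ (V 0) g := by
    intro r hr
    have := constant_of_has_deriv_right_zero (a := 0) (b := r)
      (f := fun r : ℝ => inner ℝ (V r.toNNReal) (T r.toNNReal g)) ?_ ?_ r ⟨hr, le_rfl⟩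
    · simpa [hT.zero] using this
    · refine Continuous.continuousOn (continuous_iff_continuousAt.2 fun y => ?_)
      exact hpair _ y _ _ le_rfl ((hT.continuous_orbit_real g).tendsto y)
    · intro y hy
      have hd1 : HasDerivWithinAt (fun s : ℝ => inner ℝ (V s.toNNReal)
          (T s.toNNReal g - T y.toNNReal g)) (inner ℝ (V y.toNNReal) (T y.toNNReal h)) (Ici y) y := by
        rw [← hasDerivWithinAt_Ioi_iff_Ici, hasDerivWithinAt_iff_tendsto_slope' (by simp)]
        refine (hpair _ y _ _ nhdsWithin_le_nhds (hT.tendsto_slope hg hy.1)).congr fun s => ?_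
        simp [slope, inner_smul_right]
      have hd2 : HasDerivWithinAt (fun s : ℝ => inner ℝ (V s.toNNReal) (T y.toNNReal g))
          (-inner ℝ (V y.toNNReal) (T y.toNNReal h)) (Ici y) y := by
        have hgen := hT.isGenerator_map hg y.toNNReal
        have h1 := ((hcont (T y.toNNReal h)).integral_hasStrictDerivAt 0 y).hasDerivAt.const_sub
          (inner ℝ (V 0) (T y.toNNReal g))
        refine h1.hasDerivWithinAt.congr (fun s hs => ?_) ?_
        · exact hV' _ _ hgen s (hy.1.trans hs)
        · exact hV' _ _ hgen y hy.1
      have hd := hd1.fun_add hd2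
      rw [add_neg_cancel] at hd
      refine hd.congr (fun s _ => ?_) ?_
      · rw [← inner_add_right, sub_add_cancel]
      · rw [← inner_add_right, sub_add_cancel]
  have hlim : Tendsto (fun r : ℝ => inner ℝ (V r.toNNReal) (T r.toNNReal g)) atTop (𝓝 0) := by
    have h1 : Tendsto (fun r : ℝ => ‖V r.toNNReal‖ * ‖g‖) atTop (𝓝 0) := by
      have := ((hV0.comp Real.tendsto_toNNReal_atTop).norm).mul_const ‖g‖
      simpa using this
    refine squeeze_zero_norm (fun r => (norm_inner_le_norm _ _).trans ?_) h1
    gcongr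
    exact hT.norm_le _ _
  refine tendsto_nhds_unique (tendsto_const_nhds.congr' ?_) hlim
  filter_upwards [eventually_ge_atTop 0] with r hr using (hconst r hr).symm

end IsSymmetricSemigroup

end Semigroup

/-! ### Existence and uniqueness of weak solutions in a Hilbert space -/

section WeakSolution

variable {H : Type*} [NormedAddCommGroup H] [InnerProductSpace ℝ H] {ν : Measure ℝ}

theorem continuous_comp_max_zero {E : Type*} [TopologicalSpace E] {u : ℝ → E}
    (hu : ContinuousOn u (Ici 0)) : Continuous fun s => u (max s 0) :=
  hu.comp_continuous (continuous_id.max continuous_const) fun s => le_max_right s 0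

theorem setIntegral_Ioc_comp_sub_left {E : Type*} [NormedAddCommGroup E] [NormedSpace ℝ E]
    (F : ℝ → E) (t : ℝ) : ∫ s in Ioc 0 t, F (t - s) = ∫ x in Ioc 0 t, F x := by
  rcases le_or_gt 0 t with ht | ht
  · rw [← intervalIntegral.integral_of_le ht, ← intervalIntegral.integral_of_le ht,
      intervalIntegral.integral_comp_sub_left]
    simp
  · simp [Ioc_eq_empty (not_lt.2 ht.le)]

theorem integrableOn_levyTail_sub (hν : ∫⁻ s in Ioi (0 : ℝ), ENNReal.ofReal (min 1 s) ∂ν < ∞)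
    (t : ℝ) : IntegrableOn (fun s => levyTail ν (t - s)) (Ioc 0 t) := by
  rcases le_or_gt 0 t with ht | ht
  · have h1 : IntervalIntegrable (levyTail ν) volume 0 t :=
      (intervalIntegrable_iff_integrableOn_Ioc_of_le ht).2 (integrableOn_levyTail hν t)
    have h2 := (h1.comp_sub_left t).symm
    simp only [sub_self, sub_zero] at h2
    exact (intervalIntegrable_iff_integrableOn_Ioc_of_le ht).1 h2
  · simp [Ioc_eq_empty (not_lt.2 ht.le)]

/-- Absolute convergence of `∫_0^t w(t - s) y(s) ds` for continuous `y`. -/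
theorem integrableOn_levyTail_smul
    (hν : ∫⁻ s in Ioi (0 : ℝ), ENNReal.ofReal (min 1 s) ∂ν < ∞)
    {y : ℝ → H} (hy : ContinuousOn y (Ici 0)) (t : ℝ) :
    IntegrableOn (fun s => levyTail ν (t - s) • y s) (Ioc 0 t) := by
  have hsub : Ioc 0 t ⊆ Ici 0 := fun s hs => hs.1.le
  obtain ⟨B, hB⟩ := (isCompact_Icc (a := 0) (b := t)).exists_bound_of_continuousOn
    (hy.mono Icc_subset_Ici_self)
  have h1 := integrableOn_levyTail_sub hν t
  refine (h1.mul_const B).mono' (h1.1.smul ((hy.mono hsub).aestronglyMeasurable measurableSet_Ioc)) ?_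
  filter_upwards [ae_restrict_mem measurableSet_Ioc] with s hs
  rw [norm_smul, Real.norm_of_nonneg (levyTail_nonneg _)]
  exact mul_le_mul_of_nonneg_left (hB s ⟨hs.1.le, hs.2⟩) (levyTail_nonneg _)

variable [CompleteSpace H]

theorem real_inner_integral_left {α : Type*} [MeasurableSpace α] {m : Measure α} {F : α → H}
    (hF : Integrable F m) (x : H) : inner ℝ (∫ a, F a ∂m) x = ∫ a, inner ℝ (F a) x ∂m := by
  rw [real_inner_comm, ← integral_inner hF]
  exact integral_congr_ae (ae_of_all _ fun a => real_inner_comm _ _)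

theorem inner_setIntegral_levyTail_smul
    (hν : ∫⁻ s in Ioi (0 : ℝ), ENNReal.ofReal (min 1 s) ∂ν < ∞)
    {y : ℝ → H} (hy : ContinuousOn y (Ici 0)) (g : H) (t : ℝ) :
    inner ℝ g (∫ s in Ioc 0 t, levyTail ν (t - s) • y s)
      = ∫ x in Ioc 0 t, levyTail ν x * inner ℝ (y (t - x)) g := by
  rw [← integral_inner (integrableOn_levyTail_smul hν hy t),
    ← setIntegral_Ioc_comp_sub_left (fun x => levyTail ν x * inner ℝ (y (t - x)) g)]
  simp only [inner_smul_right, sub_sub_cancel, real_inner_comm]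

variable {Ω : Type*} [MeasurableSpace Ω] {σ : ℝ≥0 → Ω → ℝ} {e : ℝ → Ω → ℝ≥0} {Pr : Measure Ω}
  [IsProbabilityMeasure Pr] {T : ℝ≥0 → H → H}

omit [CompleteSpace H] in
theorem IsSymmetricSemigroup.integrable_comp_inverse (hT : IsSymmetricSemigroup T)
    (h : IsInversePair σ e) (f : H) (t : ℝ) : Integrable (fun ω => T (e t ω) f) Pr := by
  have hm : Measurable (e t) := h.measurable_right.comp measurable_prodMk_left
  refine (integrable_const ‖f‖).mono' ?_ (ae_of_all _ fun ω => hT.norm_le _ _)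
  exact ((hT.continuous_orbit f).stronglyMeasurable.comp_measurable hm).aestronglyMeasurable

omit [CompleteSpace H] in
theorem IsSymmetricSemigroup.continuous_integral_comp_inverse (hT : IsSymmetricSemigroup T)
    (h : IsInversePair σ e) (f : H) : Continuous fun t => ∫ ω, T (e t ω) f ∂Pr :=
  continuous_of_dominated (fun t => (hT.integrable_comp_inverse h f t).1)
    (fun _ => ae_of_all _ fun _ => hT.norm_le _ _) (integrable_const ‖f‖)
    (ae_of_all _ fun ω => (hT.continuous_orbit f).comp (h.continuous ω))

theorem IsSymmetricSemigroup.inner_integral_comp_inverse (hT : IsSymmetricSemigroup T)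
    (h : IsInversePair σ e) (f x : H) (t : ℝ) :
    inner ℝ (∫ ω, T (e t ω) f ∂Pr) x = ∫ ω, inner ℝ f (T (e t ω) x) ∂Pr := by
  rw [real_inner_integral_left (hT.integrable_comp_inverse h f t)]
  simp only [hT.symm]

/-- Symmetry moves the semigroup onto g, so f need not lie in the domain. The identity for e is
applied with k(a) = ⟨f, T_a Lg⟩ and η(a) = ⟨f, T_a g⟩. -/
theorem IsSymmetricSemigroup.inner_fracIntegral_eq (hT : IsSymmetricSemigroup T)
    (h : IsInversePair σ e) (hν : ∫⁻ s in Ioi (0 : ℝ), ENNReal.ofReal (min 1 s) ∂ν < ∞)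
    (hinf : ν (Ioi 0) = ∞)
    (hφ : ∀ (a : ℝ≥0) (l : ℝ), 0 < l →
      ∫ ω, Real.exp (-(l * σ a ω)) ∂Pr = Real.exp (-(a * laplaceExponent ν l)))
    (f : H) {g Lg : H} (hg : IsGenerator T g Lg) (t : ℝ) :
    inner ℝ g (∫ s in Ioc 0 t, levyTail ν (t - s) • ((∫ ω, T (e s ω) f ∂Pr) - f))
      = ∫ s in Ioc 0 t, inner ℝ (∫ ω, T (e s ω) f ∂Pr) Lg := by
  rw [inner_setIntegral_levyTail_smul hν (y := fun s => (∫ ω, T (e s ω) f ∂Pr) - f)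
    ((hT.continuous_integral_comp_inverse h f).sub continuous_const).continuousOn]
  have key := integral_comp_inverse_eq h hν hinf hφ
    (k := fun a => inner ℝ f (T a.toNNReal Lg)) (η := fun a => inner ℝ f (T a.toNNReal g))
    (continuous_const.inner (hT.continuous_orbit_real Lg)) (B := ‖f‖ * ‖Lg‖)
    (fun a => (abs_real_inner_le_norm _ _).trans (by gcongr; exact hT.norm_le _ _))
    (fun r hr => by
      rw [hT.integral_inner_generator hg f hr, Real.toNNReal_zero, hT.zero]) t
  simp only [Real.toNNReal_coe, Real.toNNReal_zero, hT.zero] at key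
  simp only [hT.inner_integral_comp_inverse h, key, inner_sub_left]
  congr 1 with x
  rw [integral_sub _ (integrable_const _)]
  · simp
  · have := (hT.integrable_comp_inverse (Pr := Pr) h g (t - x)).const_inner (𝕜 := ℝ) f
    exact this

theorem IsSymmetricSemigroup.hasDerivAt_inner_fracIntegral (hT : IsSymmetricSemigroup T)
    (h : IsInversePair σ e) (hν : ∫⁻ s in Ioi (0 : ℝ), ENNReal.ofReal (min 1 s) ∂ν < ∞)
    (hinf : ν (Ioi 0) = ∞)
    (hφ : ∀ (a : ℝ≥0) (l : ℝ), 0 < l →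
      ∫ ω, Real.exp (-(l * σ a ω)) ∂Pr = Real.exp (-(a * laplaceExponent ν l)))
    (f : H) {g Lg : H} (hg : IsGenerator T g Lg) {t : ℝ} (ht : 0 < t) :
    HasDerivAt (fun r => inner ℝ g (∫ s in Ioc 0 r,
      levyTail ν (r - s) • ((∫ ω, T (e s ω) f ∂Pr) - f)))
      (inner ℝ (∫ ω, T (e t ω) f ∂Pr) Lg) t := by
  have hc : Continuous fun s => inner ℝ (∫ ω, T (e s ω) f ∂Pr) Lg :=
    (hT.continuous_integral_comp_inverse h f).inner continuous_const
  refine (hc.integral_hasStrictDerivAt 0 t).hasDerivAt.congr_of_eventuallyEq ?_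
  filter_upwards [Ioi_mem_nhds ht] with r hr
  rw [hT.inner_fracIntegral_eq h hν hinf hφ f hg, intervalIntegral.integral_of_le (le_of_lt hr)]

/-- The weak equation in integrated form, for the difference of two weak solutions. -/
theorem setIntegral_levyTail_mul_eq_of_hasDerivAt
    (hν : ∫⁻ s in Ioi (0 : ℝ), ENNReal.ofReal (min 1 s) ∂ν < ∞) {c k : ℝ → ℝ}
    (hc : Continuous c) (hk : Continuous k)
    (hd : ∀ t > 0, HasDerivAt (fun r => ∫ x in Ioc 0 r, levyTail ν x * c (r - x)) (k t) t)
    {t : ℝ} (ht : 0 ≤ t) :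
    ∫ x in Ioc 0 t, levyTail ν x * c (t - x) = ∫ s in (0 : ℝ)..t, k s := by
  have hcont : ContinuousOn (fun r => ∫ x in Ioc 0 r, levyTail ν x * c (r - x)) (Icc 0 t) := by
    intro y hy
    rcases hy.1.eq_or_lt with rfl | hy0
    -- No derivative is given at 0; there the convolution is bounded by B ∫_0^r w, which tends to 0.
    · rw [ContinuousWithinAt, Ioc_self, Measure.restrict_empty, integral_zero_measure]
      obtain ⟨B, hB⟩ := (isCompact_Icc (a := 0) (b := t)).exists_bound_of_continuousOn hc.continuousOn
      have hii : IntegrableOn (levyTail ν) (Icc 0 t) := by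
        rw [integrableOn_Icc_iff_integrableOn_Ioc]
        exact integrableOn_levyTail hν t
      have h1 := (intervalIntegral.continuousOn_primitive hii) 0 ⟨le_rfl, ht⟩
      rw [ContinuousWithinAt, Ioc_self, Measure.restrict_empty, integral_zero_measure] at h1
      refine squeeze_zero_norm' ?_ (by simpa using h1.const_mul B)
      filter_upwards [self_mem_nhdsWithin] with r hr
      rw [← integral_const_mul]
      refine norm_integral_le_of_norm_le ((integrableOn_levyTail hν r).const_mul B) ?_
      filter_upwards [ae_restrict_mem measurableSet_Ioc] with x hx
      rw [norm_mul, Real.norm_of_nonneg (levyTail_nonneg _), mul_comm]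
      exact mul_le_mul_of_nonneg_right
        (hB _ ⟨by linarith [hx.2], by linarith [hx.1, hr.2]⟩) (levyTail_nonneg _)
    · exact (hd y hy0).continuousAt.continuousWithinAt
  rw [intervalIntegral.integral_eq_sub_of_hasDeriv_right_of_le ht hcont
    (fun y hy => (hd y hy.1).hasDerivWithinAt) (hk.intervalIntegrable _ _)]
  simp

/-- A continuous `v` with `v = 0` on `(-∞, 0]` and `w * v = L (1 * v)` weakly vanishes. -/
theorem IsSymmetricSemigroup.eq_zero_of_convolution_eq (hT : IsSymmetricSemigroup T)
    (h : IsInversePair σ e) (hν : ∫⁻ s in Ioi (0 : ℝ), ENNReal.ofReal (min 1 s) ∂ν < ∞)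
    (hinf : ν (Ioi 0) = ∞)
    (hφ : ∀ (a : ℝ≥0) (l : ℝ), 0 < l →
      ∫ ω, Real.exp (-(l * σ a ω)) ∂Pr = Real.exp (-(a * laplaceExponent ν l)))
    {v : ℝ → H} (hv : Continuous v) (hv0 : ∀ s ≤ 0, v s = 0)
    (heq : ∀ g Lg, IsGenerator T g Lg → ∀ t > 0,
      ∫ x in Ioc 0 t, levyTail ν x * inner ℝ (v (t - x)) g = ∫ s in (0 : ℝ)..t, inner ℝ (v s) Lg)
    (t : ℝ) : v t = 0 := by
  set b : ℝ → H := fun t => ∫ s in (0 : ℝ)..t, v s with hb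
  have hii : ∀ p q, IntervalIntegrable v volume p q := fun p q => hv.intervalIntegrable p q
  have hbc : Continuous b := intervalIntegral.continuous_primitive hii 0
  have hb0 : ∀ s ≤ 0, b s = 0 := by
    intro s hs
    rw [hb]
    refine (intervalIntegral.integral_congr (g := fun _ => 0) fun x hx => ?_).trans (by simp)
    rw [uIcc_of_ge hs] at hx
    exact hv0 x hx.2
  have hbinner : ∀ s x, inner ℝ (b s) x = ∫ y in (0 : ℝ)..s, inner ℝ (v y) x := by
    intro s x
    have := (innerSL ℝ x).intervalIntegral_comp_comm (hii 0 s)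
    simp only [innerSL_apply_apply] at this
    rw [real_inner_comm, ← this]
    simp only [real_inner_comm]
  suffices hbt : ∀ t, b t = 0 by
    have h1 : HasDerivAt b (v t) t := (hv.integral_hasStrictDerivAt 0 t).hasDerivAt
    rw [funext hbt] at h1
    exact h1.unique (hasDerivAt_const t 0)
  intro t
  obtain ⟨C, hC⟩ := (isCompact_Icc (a := 0) (b := t)).exists_bound_of_continuousOn hbc.continuousOn
  -- A bound up to time t is enough, since t - σ_r ≤ t.
  have hC' : ∀ s ≤ t, ‖b s‖ ≤ max C 0 := by
    intro s hs
    rcases le_total 0 s with h0 | h0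
    · exact (hC s ⟨h0, hs⟩).trans (le_max_left _ _)
    · rw [hb0 s h0, norm_zero]
      exact le_max_right _ _
  have hCσ : ∀ r ω, ‖b (t - σ r ω)‖ ≤ max C 0 := fun r ω => hC' _ (by linarith [h.nonneg r ω])
  have hbi : ∀ r, Integrable (fun ω => b (t - σ r ω)) Pr := by
    intro r
    refine (integrable_const (max C 0)).mono' ?_ (ae_of_all _ (hCσ r))
    exact (hbc.stronglyMeasurable.comp_measurable
      ((h.measurable_apply r).const_sub t)).aestronglyMeasurable
  -- V(0) = b(t) because σ_0 = 0.
  have key := hT.eq_zero_of_backward (V := fun r => ∫ ω, b (t - σ r ω) ∂Pr) (C := max C 0)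
    ?_ (fun r => ?_) ?_ ?_
  · simpa [h.zero] using key
  · have hsm : StronglyMeasurable fun p : ℝ × Ω => b (t - σ p.1.toNNReal p.2) :=
      hbc.stronglyMeasurable.comp_measurable (h.measurable_toNNReal.const_sub t)
    exact hsm.integral_prod_right.aestronglyMeasurable
  · refine (norm_integral_le_of_norm_le (integrable_const (max C 0)) (ae_of_all _ (hCσ r))).trans ?_
    simp
  · have : Tendsto (fun r => ∫ ω, b (t - σ r ω) ∂Pr) atTop (𝓝 (∫ _, (0 : H) ∂Pr)) := by
      refine tendsto_integral_filter_of_dominated_convergence (fun _ => max C 0)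
        (Eventually.of_forall fun r => (hbi r).1)
        (Eventually.of_forall fun r => ae_of_all _ (hCσ r)) (integrable_const _)
        (ae_of_all _ fun ω => ?_)
      refine tendsto_const_nhds.congr' ?_
      filter_upwards [(h.tendsto ω).eventually_ge_atTop t] with r hr
      rw [hb0 _ (by linarith)]
    simpa using this
  · intro g Lg hg r
    have hcg : Continuous fun s => inner ℝ (v s) g := hv.inner continuous_const
    have h1 := integral_primitive_sub_eq h hν hinf hφ (c := fun s => inner ℝ (v s) g)
      (K := fun s => inner ℝ (b s) Lg) hcg
      (fun s hs => by rw [hv0 s hs, inner_zero_left]) (fun s hs => by rw [hb0 s hs, inner_zero_left])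
      (fun s hs => by rw [hbinner]; exact heq g Lg hg s hs) r t
    rw [intervalIntegral.integral_of_le r.coe_nonneg]
    simp only [real_inner_integral_left (hbi _)]
    rw [← h1]
    have h3 : ∀ a, Integrable (fun ω => inner ℝ (b (t - σ a ω)) g) Pr := fun a =>
      (hbi a).inner_const g
    rw [← integral_sub (h3 0) (h3 r)]
    congr 1 with ω
    rw [h.zero, sub_zero, hbinner, hbinner,
      intervalIntegral.integral_interval_sub_left (hcg.intervalIntegrable _ _)
        (hcg.intervalIntegrable _ _), ← intervalIntegral.integral_of_le (h.nonneg r ω),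
      intervalIntegral.integral_comp_sub_left (fun s => inner ℝ (v s) g), sub_zero]

theorem IsSymmetricSemigroup.weakSolution_unique (hT : IsSymmetricSemigroup T)
    (h : IsInversePair σ e) (hν : ∫⁻ s in Ioi (0 : ℝ), ENNReal.ofReal (min 1 s) ∂ν < ∞)
    (hinf : ν (Ioi 0) = ∞)
    (hφ : ∀ (a : ℝ≥0) (l : ℝ), 0 < l →
      ∫ ω, Real.exp (-(l * σ a ω)) ∂Pr = Real.exp (-(a * laplaceExponent ν l)))
    {f : H} {u₁ u₂ : ℝ → H} (hu₁ : ContinuousOn u₁ (Ici 0)) (hu₂ : ContinuousOn u₂ (Ici 0))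
    (h₀ : u₁ 0 = u₂ 0)
    (hd₁ : ∀ g Lg, IsGenerator T g Lg → ∀ t > 0, HasDerivAt (fun r => inner ℝ g
      (∫ s in Ioc 0 r, levyTail ν (r - s) • (u₁ s - f))) (inner ℝ (u₁ t) Lg) t)
    (hd₂ : ∀ g Lg, IsGenerator T g Lg → ∀ t > 0, HasDerivAt (fun r => inner ℝ g
      (∫ s in Ioc 0 r, levyTail ν (r - s) • (u₂ s - f))) (inner ℝ (u₂ t) Lg) t)
    {t : ℝ} (ht : 0 ≤ t) : u₁ t = u₂ t := by
  -- Equal initial values make this extension of the difference vanish at negative times.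
  have hv : Continuous fun s => u₁ (max s 0) - u₂ (max s 0) :=
    (continuous_comp_max_zero hu₁).sub (continuous_comp_max_zero hu₂)
  have key := hT.eq_zero_of_convolution_eq h hν hinf hφ hv
    (fun s hs => by simp only [max_eq_right hs, h₀, sub_self]) (fun g Lg hg t ht => ?_) t
  · simp only [max_eq_left ht] at key
    exact sub_eq_zero.1 key
  · refine setIntegral_levyTail_mul_eq_of_hasDerivAt hν (hv.inner continuous_const)
      (hv.inner continuous_const) (fun s hs => ?_) ht.le
    have h1 := (hd₁ g Lg hg s hs).fun_sub (hd₂ g Lg hg s hs)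
    rw [← inner_sub_left] at h1
    simp only [max_eq_left (le_of_lt hs)]
    refine h1.congr_of_eventuallyEq (Eventually.of_forall fun r => ?_)
    have hi₁ : IntegrableOn (fun s => levyTail ν (r - s) • (u₁ s - f)) (Ioc 0 r) :=
      integrableOn_levyTail_smul hν (hu₁.sub continuousOn_const) r
    have hi₂ : IntegrableOn (fun s => levyTail ν (r - s) • (u₂ s - f)) (Ioc 0 r) :=
      integrableOn_levyTail_smul hν (hu₂.sub continuousOn_const) r
    have h2 := inner_setIntegral_levyTail_smul hν (y := fun s => u₁ s - u₂ s) (hu₁.sub hu₂) g r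
    beta_reduce
    rw [← inner_sub_right, ← integral_sub hi₁ hi₂]
    simp only [← smul_sub, sub_sub_sub_cancel_right]
    rw [h2]
    refine setIntegral_congr_fun measurableSet_Ioc fun x hx => ?_
    rw [max_eq_left (by linarith [hx.2])]

end WeakSolution

/-! ### The L² semigroup of the process -/

namespace StrongMarkovProcess

variable {M Ω : Type*} [MeasurableSpace M] [MeasurableSpace Ω] {X : StrongMarkovProcess M Ω}
  {μ : Measure M}

theorem kernel_apply (X : StrongMarkovProcess M Ω) (t : ℝ≥0) (x : M) :
    X.kernel t x = ((X.P (Sum.inl x)).map (X.X t)).comap Sum.inl := rfl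

theorem kernel_zero (X : StrongMarkovProcess M Ω) (x : M) : X.kernel 0 x = Measure.dirac x := by
  ext B hB
  have := X.isProbabilityMeasure (Sum.inl x)
  rw [kernel_apply, X.transition_apply 0 x hB, Measure.dirac_apply' _ hB]
  have h : (X.X 0 ⁻¹' (Sum.inl '' B) : Set Ω) =ᵐ[X.P (Sum.inl x)] {_ω | x ∈ B} := by
    filter_upwards [X.start (Sum.inl x)] with ω h0
    refine propext ?_
    change X.X 0 ω ∈ Sum.inl '' B ↔ x ∈ B
    rw [h0]
    simp
  rw [measure_congr h]
  by_cases hx : x ∈ B <;> simp [hx]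

theorem prob_cemetery (X : StrongMarkovProcess M Ω) (t : ℝ≥0) (u : Unit) (B : Set M) :
    X.P (Sum.inr u) (X.X t ⁻¹' (Sum.inl '' B)) = 0 := by
  have h := ae_iff.1 (X.start (Sum.inr u))
  refine measure_mono_null ?_ h
  intro ω hω h0
  have h1 := X.absorbed 0 t ω (zero_le (a := t)) h0
  rw [mem_preimage, h1] at hω
  obtain ⟨x, -, hx⟩ := hω
  exact Sum.inl_ne_inr hx

/-- Chapman–Kolmogorov, from the strong Markov property at the constant time s. Paths already at the
cemetery contribute nothing, as it is absorbing. -/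
theorem kernel_add (X : StrongMarkovProcess M Ω) (s t : ℝ≥0) :
    X.kernel (s + t) = X.kernel t ∘ₖ X.kernel s := by
  ext x B hB
  have hB' : MeasurableSet (Sum.inl '' B : Set (M ⊕ Unit)) := measurableSet_inl_image.2 hB
  have h1 := X.strong_markov (fun _ => (s : WithTop ℝ≥0)) (isStoppingTime_const X.𝓕 s) t (Sum.inl x)
    (Sum.inl '' B) univ hB' MeasurableSet.univ (fun ω _ => WithTop.coe_ne_top)
  simp only [univ_inter, WithTop.untopD_coe, Measure.restrict_univ] at h1
  rw [Kernel.comp_apply' _ _ _ hB]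
  rw [kernel_apply, X.transition_apply (s + t) x hB]
  refine h1.trans ?_
  have hF := X.measurable_prob t _ hB'
  have h2 : ∀ y, X.kernel t y B = X.P (Sum.inl y) (X.X t ⁻¹' (Sum.inl '' B)) := fun y =>
    X.transition_apply t y hB
  simp only [h2]
  rw [kernel_apply, ← measurableEmbedding_inl.lintegral_map
    (f := fun z => X.P z (X.X t ⁻¹' (Sum.inl '' B))), measurableEmbedding_inl.map_comap,
    ← lintegral_indicator measurableEmbedding_inl.measurableSet_range,
    ← lintegral_map (f := fun z => X.P z (X.X t ⁻¹' (Sum.inl '' B))) hF (X.measurable_X s)]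
  refine lintegral_congr fun z => ?_
  rcases z with y | u
  · rw [indicator_of_mem (mem_range_self y)]
  · rw [indicator_of_notMem (by simp), X.prob_cemetery]

namespace IsSymmetric

variable (hX : X.IsSymmetric μ)
include hX

/-- Symmetry tested against 1 shows that μ is subinvariant, so a μ-null set is null for almost every
transition measure. -/
theorem ae_ae_kernel (t : ℝ≥0) {p : M → Prop} (h : ∀ᵐ y ∂μ, p y) :
    ∀ᵐ x ∂μ, ∀ᵐ y ∂X.kernel t x, p y := by
  obtain ⟨N, hN, hNm, hN0⟩ := exists_measurable_superset_of_null (ae_iff.1 h)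
  have h1 := hX.lintegral_le t (measurable_one.indicator hNm : Measurable (N.indicator 1))
  rw [lintegral_indicator_one hNm, hN0, nonpos_iff_eq_zero] at h1
  simp_rw [lintegral_indicator_one hNm] at h1
  rw [lintegral_eq_zero_iff ((X.kernel t).measurable_coe hNm)] at h1
  filter_upwards [h1] with x hx
  exact ae_iff.2 (measure_mono_null hN hx)

theorem ae_integrable_kernel (t : ℝ≥0) {f : M → ℝ} (hf : MemLp f 2 μ) :
    ∀ᵐ x ∂μ, Integrable f (X.kernel t x) := by
  obtain ⟨g, hg, hfg⟩ := hf.1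
  have hg2 : MemLp g 2 μ := (memLp_congr_ae hfg).1 hf
  have hgm := hg.measurable
  have hfin := (eLpNorm_lt_top_iff_lintegral_rpow_enorm_lt_top (p := 2) (by norm_num)
    (by norm_num)).1 hg2.2
  have hle := hX.lintegral_le t (f := fun y => ‖g y‖ₑ ^ (2 : ℝ≥0∞).toReal) (by fun_prop)
  have hlt := ae_lt_top (Measurable.lintegral_kernel (κ := X.kernel t)
    (f := fun y => ‖g y‖ₑ ^ (2 : ℝ≥0∞).toReal) (by fun_prop)) (hle.trans_lt hfin).ne
  filter_upwards [hlt, hX.ae_ae_kernel t hfg] with x hx hxe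
  have h2 : MemLp g 2 (X.kernel t x) :=
    ⟨hg.aestronglyMeasurable, (eLpNorm_lt_top_iff_lintegral_rpow_enorm_lt_top (p := 2)
      (by norm_num) (by norm_num)).2 hx⟩
  exact (integrable_congr hxe).2 (h2.integrable one_le_two)

/-- Cauchy–Schwarz against a kernel of mass at most 1 gives |T_t f|² ≤ T_t(|f|²); subinvariance of μ
does the rest. -/
theorem eLpNorm_transition_le (t : ℝ≥0) {f : M → ℝ} (hf : AEStronglyMeasurable f μ) :
    eLpNorm (X.transition t f) 2 μ ≤ eLpNorm f 2 μ := by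
  obtain ⟨g, hg, hfg⟩ := hf
  rw [eLpNorm_congr_ae (hX.transition_congr t hfg), eLpNorm_congr_ae hfg,
    eLpNorm_eq_lintegral_rpow_enorm_toReal (by norm_num) (by norm_num),
    eLpNorm_eq_lintegral_rpow_enorm_toReal (by norm_num) (by norm_num)]
  refine ENNReal.rpow_le_rpow ?_ (by norm_num)
  refine le_trans (lintegral_mono fun x => ?_)
    (hX.lintegral_le t (f := fun y => ‖g y‖ₑ ^ (2 : ℝ≥0∞).toReal) (by
      have := hg.measurable
      fun_prop))
  have h1 : ‖X.transition t g x‖ₑ ≤ ∫⁻ y, ‖g y‖ₑ ∂X.kernel t x := enorm_integral_le_lintegral_enorm _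
  have h2 := ENNReal.lintegral_mul_le_Lp_mul_Lq (X.kernel t x) Real.HolderConjugate.two_two
    (f := fun y => ‖g y‖ₑ) (g := 1) hg.measurable.enorm.aemeasurable aemeasurable_one
  simp only [Pi.mul_apply, Pi.one_apply, mul_one, ENNReal.one_rpow, lintegral_const, one_mul] at h2
  have h3 : (X.kernel t x univ) ^ (1 / 2 : ℝ) ≤ 1 :=
    ENNReal.rpow_le_one (X.kernel_univ_le t x) (by norm_num)
  have h4 := h1.trans (h2.trans (mul_le_of_le_one_right' h3))
  calc ‖X.transition t g x‖ₑ ^ (2 : ℝ≥0∞).toReal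
      ≤ ((∫⁻ y, ‖g y‖ₑ ^ (2 : ℝ) ∂X.kernel t x) ^ (1 / 2 : ℝ)) ^ (2 : ℝ) := by
        simp only [ENNReal.toReal_ofNat]
        exact ENNReal.rpow_le_rpow h4 (by norm_num)
    _ = ∫⁻ y, ‖g y‖ₑ ^ (2 : ℝ≥0∞).toReal ∂X.kernel t x := by
        rw [← ENNReal.rpow_mul]; norm_num

theorem coeFn_T (t : ℝ≥0) (f : Lp ℝ 2 μ) : T hX t f =ᵐ[μ] X.transition t f :=
  MemLp.coeFn_toLp _

theorem T_add (t : ℝ≥0) (f g : Lp ℝ 2 μ) : T hX t (f + g) = T hX t f + T hX t g := by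
  refine Lp.ext ?_
  filter_upwards [hX.coeFn_T t (f + g), hX.coeFn_T t f, hX.coeFn_T t g,
    Lp.coeFn_add (T hX t f) (T hX t g), hX.transition_congr t (Lp.coeFn_add f g),
    hX.ae_integrable_kernel t (Lp.memLp f), hX.ae_integrable_kernel t (Lp.memLp g)]
    with x h1 h2 h3 h4 h5 h6 h7
  rw [h1, h4, Pi.add_apply, h2, h3, h5]
  exact integral_add h6 h7

theorem T_smul (t : ℝ≥0) (c : ℝ) (f : Lp ℝ 2 μ) : T hX t (c • f) = c • T hX t f := by
  refine Lp.ext ?_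
  filter_upwards [hX.coeFn_T t (c • f), hX.coeFn_T t f,
    Lp.coeFn_smul c (T hX t f), hX.transition_congr t (Lp.coeFn_smul c f)]
    with x h1 h2 h3 h4
  rw [h1, h3, Pi.smul_apply, h2, h4]
  exact integral_smul c _

theorem norm_T_le (t : ℝ≥0) (f : Lp ℝ 2 μ) : ‖T hX t f‖ ≤ ‖f‖ := by
  rw [T, Lp.norm_toLp, Lp.norm_def]
  exact ENNReal.toReal_mono (Lp.eLpNorm_ne_top f) (hX.eLpNorm_transition_le t (Lp.memLp f).1)

theorem T_zero [MeasurableSingletonClass M] (f : Lp ℝ 2 μ) : T hX 0 f = f := by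
  refine Lp.ext ?_
  filter_upwards [hX.coeFn_T 0 f] with x h1
  rw [h1, transition, X.kernel_zero, integral_dirac]

theorem T_comp (s t : ℝ≥0) (f : Lp ℝ 2 μ) : T hX (s + t) f = T hX s (T hX t f) := by
  refine Lp.ext ?_
  filter_upwards [hX.coeFn_T (s + t) f, hX.coeFn_T s (T hX t f),
    hX.transition_congr s (hX.coeFn_T t f), hX.ae_integrable_kernel (s + t) (Lp.memLp f)]
    with x h1 h2 h3 h4
  rw [h1, h2, h3, transition, X.kernel_add s t]
  rw [X.kernel_add s t] at h4
  exact Kernel.integral_comp h4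

/-- Symmetry is assumed for Borel functions with values in [0, ∞], so it is transferred through
measurable versions of f and g; signed functions follow by splitting into positive and negative
parts. -/
theorem inner_T_of_nonneg (t : ℝ≥0) {f g : Lp ℝ 2 μ} (hf : 0 ≤ f) (hg : 0 ≤ g) :
    inner ℝ (T hX t f) g = inner ℝ f (T hX t g) := by
  have hlin : ∀ f : Lp ℝ 2 μ, 0 ≤ f → ∃ F : M → ℝ≥0∞, Measurable F ∧
      (∀ᵐ x ∂μ, ENNReal.ofReal (f x) = F x) ∧ (0 ≤ᵐ[μ] f) ∧ (0 ≤ᵐ[μ] T hX t f) ∧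
      ∀ᵐ x ∂μ, ENNReal.ofReal (T hX t f x) = ∫⁻ y, F y ∂X.kernel t x := by
    intro f hf
    have hf0 := (Lp.coeFn_nonneg f).2 hf
    have hm : AEMeasurable (fun x => ENNReal.ofReal (f x)) μ :=
      (Lp.aestronglyMeasurable f).aemeasurable.ennreal_ofReal
    refine ⟨hm.mk _, hm.measurable_mk, hm.ae_eq_mk, hf0, ?_, ?_⟩
    · filter_upwards [hX.coeFn_T t f, hX.ae_ae_kernel t hf0] with x h1 h2
      rw [h1]
      exact integral_nonneg_of_ae h2
    · filter_upwards [hX.coeFn_T t f, hX.ae_ae_kernel t hf0, hX.ae_ae_kernel t hm.ae_eq_mk,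
        hX.ae_integrable_kernel t (Lp.memLp f)] with x h1 h2 h3 h4
      rw [h1, transition, ofReal_integral_eq_lintegral_ofReal h4 h2]
      exact lintegral_congr_ae h3
  obtain ⟨F, hFm, hF, hf0, hTf0, hTF⟩ := hlin f hf
  obtain ⟨G, hGm, hG, hg0, hTg0, hTG⟩ := hlin g hg
  rw [L2.inner_def, L2.inner_def]
  simp only [RCLike.inner_apply, conj_trivial]
  rw [integral_eq_lintegral_of_nonneg_ae, integral_eq_lintegral_of_nonneg_ae]
  · congr 1
    have h1 := hX t F G hFm hGm
    refine ((lintegral_congr_ae ?_).trans h1).trans (lintegral_congr_ae ?_)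
    · filter_upwards [hG, hTF, hg0] with x h2 h3 h4
      rw [ENNReal.ofReal_mul h4, h2, h3, mul_comm]
    · filter_upwards [hF, hTG, hTg0] with x h2 h3 h4
      rw [ENNReal.ofReal_mul h4, h2, h3, mul_comm]
  · filter_upwards [hf0, hTg0] with x h2 h3 using mul_nonneg h3 h2
  · exact ((Lp.aestronglyMeasurable _).mul (Lp.aestronglyMeasurable _))
  · filter_upwards [hg0, hTf0] with x h2 h3 using mul_nonneg h2 h3
  · exact ((Lp.aestronglyMeasurable _).mul (Lp.aestronglyMeasurable _))

theorem T_sub (t : ℝ≥0) (f g : Lp ℝ 2 μ) : T hX t (f - g) = T hX t f - T hX t g := by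
  rw [eq_sub_iff_add_eq, ← hX.T_add, sub_add_cancel]

theorem inner_T (t : ℝ≥0) (f g : Lp ℝ 2 μ) : inner ℝ (T hX t f) g = inner ℝ f (T hX t g) := by
  have hp : ∀ f : Lp ℝ 2 μ, 0 ≤ f⁺ := fun f => posPart_nonneg f
  have hn : ∀ f : Lp ℝ 2 μ, 0 ≤ f⁻ := fun f => negPart_nonneg f
  rw [← posPart_sub_negPart f, ← posPart_sub_negPart g]
  simp only [hX.T_sub, inner_sub_left, inner_sub_right,
    hX.inner_T_of_nonneg t (hp f) (hp g), hX.inner_T_of_nonneg t (hp f) (hn g),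
    hX.inner_T_of_nonneg t (hn f) (hp g), hX.inner_T_of_nonneg t (hn f) (hn g)]

theorem isSymmetricSemigroup [MeasurableSingletonClass M] (hT : IsStronglyContinuous hX) :
    IsSymmetricSemigroup (T hX) :=
  ⟨hX.T_add, hX.T_smul, hX.norm_T_le, hX.T_zero, hX.T_comp, hX.inner_T, hT⟩

end IsSymmetric

end StrongMarkovProcess

/-! ### The main theorem -/

theorem integral_mul_eq_inner {M : Type*} [MeasurableSpace M] {μ : Measure M} (g h : Lp ℝ 2 μ) :
    ∫ x, g x * h x ∂μ = inner ℝ g h := by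
  rw [L2.inner_def]
  refine integral_congr_ae (ae_of_all _ fun x => ?_)
  simp [mul_comm]

theorem theorem2p4 {M Ω Ω' : Type*} [TopologicalSpace M] [T2Space M] [LocallyCompactSpace M]
    [MeasurableSpace M] [BorelSpace M] [MeasurableSpace Ω] [MeasurableSpace Ω']
    (μ : Measure M) [SigmaFinite μ] [μ.IsOpenPosMeasure]
    (X : StrongMarkovProcess M Ω) (hX : X.IsSymmetric μ)
    (hT : StrongMarkovProcess.IsStronglyContinuous hX)
    (ν : Measure ℝ) (hν : ν (Ioi 0) = ∞)
    (Pr : Measure Ω') [IsProbabilityMeasure Pr] (S : ℝ≥0 → Ω' → ℝ)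
    (hS : IsDriftlessSubordinator S ν Pr) (f : Lp ℝ 2 μ) :
    (∀ t : ℝ, 0 ≤ t →
      Integrable (fun ω => StrongMarkovProcess.T hX (inverseSubordinator S t ω) f) Pr) ∧
    StrongMarkovProcess.IsWeakSolution hX (levyTail ν) f
      (StrongMarkovProcess.subordinate hX S Pr f) ∧
    (∀ t : ℝ, 0 < t → IntegrableOn
      (fun s => levyTail ν (t - s) • (StrongMarkovProcess.subordinate hX S Pr f s - f))
      (Ioc 0 t)) ∧
    (∀ u : ℝ → Lp ℝ 2 μ, StrongMarkovProcess.IsWeakSolution hX (levyTail ν) f u →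
      ∀ t : ℝ, 0 ≤ t → u t = StrongMarkovProcess.subordinate hX S Pr f t) := by
  -- Almost surely e agrees with the inverse of S at all times t ≥ 0 at once, so u may be computed
  -- with e.
  obtain ⟨σ, e, hσ, hφ, he⟩ := hS.exists_isInversePair hν
  have hsg := hX.isSymmetricSemigroup hT
  have hT_eq : ∀ t, 0 ≤ t → (fun ω => StrongMarkovProcess.T hX (inverseSubordinator S t ω) f)
      =ᵐ[Pr] fun ω => StrongMarkovProcess.T hX (e t ω) f := by
    intro t ht
    filter_upwards [he] with ω hω
    rw [hω t ht]
  have hu_eq : ∀ t, 0 ≤ t → StrongMarkovProcess.subordinate hX S Pr f t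
      = ∫ ω, StrongMarkovProcess.T hX (e t ω) f ∂Pr := fun t ht => integral_congr_ae (hT_eq t ht)
  have hcont : ContinuousOn (StrongMarkovProcess.subordinate hX S Pr f) (Ici 0) :=
    (hsg.continuous_integral_comp_inverse hσ f).continuousOn.congr fun t ht => hu_eq t ht
  have hfrac : ∀ r, StrongMarkovProcess.fracIntegral (levyTail ν) f
      (StrongMarkovProcess.subordinate hX S Pr f) r
      = ∫ s in Ioc 0 r, levyTail ν (r - s) •
        ((∫ ω, StrongMarkovProcess.T hX (e s ω) f ∂Pr) - f) := by
    intro r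
    refine setIntegral_congr_fun measurableSet_Ioc fun s hs => ?_
    simp only [hu_eq s hs.1.le]
  have he0 : ∀ ω, e 0 ω = 0 := by
    intro ω
    have h1 := hσ.lt_iff 0 0 ω le_rfl
    rw [hσ.zero] at h1
    by_contra hne
    exact lt_irrefl _ (h1.2 (pos_iff_ne_zero.2 hne))
  have hweak : StrongMarkovProcess.IsWeakSolution hX (levyTail ν) f
      (StrongMarkovProcess.subordinate hX S Pr f) := by
    refine ⟨?_, hcont, fun g Lg hg t ht => ?_⟩
    · rw [hu_eq 0 le_rfl]
      simp [he0, hsg.zero]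
    · simp only [integral_mul_eq_inner, hfrac, hu_eq t ht.le]
      exact hsg.hasDerivAt_inner_fracIntegral hσ hS.levy hν hφ f hg ht
  refine ⟨fun t ht => ?_, hweak, fun t _ => ?_, fun u hu t ht => ?_⟩
  · exact (integrable_congr (hT_eq t ht)).2 (hsg.integrable_comp_inverse hσ f t)
  · exact integrableOn_levyTail_smul hS.levy (hcont.sub continuousOn_const) t
  · refine hsg.weakSolution_unique hσ hS.levy hν hφ (f := f) hu.continuousOn hcont
      (hu.initial.trans hweak.initial.symm) (fun g Lg hg t ht => ?_) (fun g Lg hg t ht => ?_) ht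
    · have := hu.hasDerivAt g Lg hg t ht
      simpa only [integral_mul_eq_inner, StrongMarkovProcess.fracIntegral] using this
    · have := hweak.hasDerivAt g Lg hg t ht
      simpa only [integral_mul_eq_inner, StrongMarkovProcess.fracIntegral] using this
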